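/- Let $M\ge 1$, $\sigma_1,\dots,\sigma_M>0$ and $0=\lambda_0<\lambda_1<\dots<\lambda_M=1$. For $n\in\mathbb{N}$ let $\mathbb{D}_k$ be the set of the $2^k$ particles at time $k$ of the binary tree, let $v_k$ denote the ancestor at time $k$ of $v\in\mathbb{D}_n$, let $Z_w$, $w\in\mathbb{D}_1\cup\dots\cup\mathbb{D}_n$, be i.i.d. $\mathcal{N}(0,1)$ random variables, and let $$S_v=\sum_{i=1}^M\ \sum_{k=\lfloor\lambda_{i-1}n\rfloor+1}^{\lfloor\lambda_i n\rfloor}\sigma_i Z_{v_k},\qquad v\in\mathbb{D}_n.$$ Put $\sigma(s)=\sigma_1\mathbf{1}_{\{0\}}(s)+\sum_{i=1}^M\sigma_i\mathbf{1}_{(\lambda_{i-1},\lambda_i]}(s)$ and $\mathcal{J}_{\sigma^2}(s)=\int_0^s\sigma^2(r)\,dr$ for $s\in[0,1]$. Let $\bar\sigma$ be the positive, non-increasing, left-continuous step function on $[0,1]$ for which $\mathcal{J}_{\bar\sigma^2}(s)=\int_0^s\bar\sigma^2(r)\,dr$ is the concave hull (least concave majorant) of $\mathcal{J}_{\sigma^2}$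 on $[0,1]$. Let $0=\lambda^0<\lambda^1<\dots<\lambda^m=1$ be such that $\lambda^1,\dots,\lambda^{m-1}$ are the points where $\bar\sigma$ jumps, and put $\bar\sigma_j=\bar\sigma(\lambda^j)$, $t^j=\lambda^j n$, $\nabla t^j=t^j-t^{j-1}$. Let $\delta_j=1$ if $\mathcal{J}_{\sigma^2}=\mathcal{J}_{\bar\sigma^2}$ on $[\lambda^{j-1},\lambda^j]$ and $\delta_j=0$ otherwise, let $g=\sqrt{2\log 2}$, and let $$M_n^\star(n)=\sum_{j=1}^m\left[g\bar\sigma_j\nabla t^j-\frac{(1+2\delta_j)\bar\sigma_j}{2g}\log(\nabla t^j)\right].$$ Assume that, for every $j$, if $\mathcal{J}_{\sigma^2}$ and $\mathcal{J}_{\bar\sigma^2}$ coincide on some nondegenerate subinterval of $[\lambda^{j-1},\lambda^j]$, then they coincide on all of $[\lambda^{j-1},\lambda^j]$. Then there are a constant $C>0$ and an integer $N$, both depending only on $(\sigma_i)_i$ and $(\lambda_i)_i$, such that for all $n\ge N$ and all $x>0$, $$\mathbb{P}\Big(\max_{v\in\mathbb{D}_n}S_v\ge M_n^\star(n)+x\Big)\le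 C\,(1+x)^{2\sum_{j=1}^m\delta_j}\,e^{-x g/\bar\sigma_1}.$$ -/

import Mathlib

open MeasureTheory ProbabilityTheory Set

noncomputable section

namespace BRW

/-- Parameters `(σ, λ)`: `M ≥ 1` variance parameters `σ_1, …, σ_M > 0` and scales
`0 = λ_0 < λ_1 < … < λ_M = 1`.  The entry `σ i` with `i : Fin M` is `σ_{i+1}`; it is attached to
the interval `(lam i.castSucc, lam i.succ] = (λ_i, λ_{i+1}]`. -/
structure Profile where
  M : ℕ
  M_pos : 0 < M
  σ : Fin M → ℝ
  σ_pos : ∀ i, 0 < σ i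
  lam : Fin (M + 1) → ℝ
  lam_strictMono : StrictMono lam
  lam_zero : lam 0 = 0
  lam_last : lam (Fin.last M) = 1

namespace Profile

/-- The first variance parameter `σ_1`. -/
def firstσ (P : Profile) : ℝ := P.σ ⟨0, P.M_pos⟩

/-- The left-continuous step function
`σ(s) = σ_1 1_{0}(s) + ∑_i σ_i 1_{(λ_{i-1}, λ_i]}(s)`. -/
def step (P : Profile) (s : ℝ) : ℝ :=
  Set.indicator {0} (fun _ => P.firstσ) s +
    ∑ i : Fin P.M, Set.indicator (Ioc (P.lam i.castSucc) (P.lam i.succ)) (fun _ => P.σ i) s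

/-- `J_{σ²}(s) = ∫_0^s σ(r)² dr`. -/
def J (P : Profile) (s : ℝ) : ℝ := ∫ r in (0 : ℝ)..s, P.step r ^ 2

end Profile

/-- The concave hull on `[0, 1]`: the smallest concave function on `[0, 1]` that dominates `f`,
given pointwise as the infimum of all concave majorants. -/
def concaveHull (f : ℝ → ℝ) (s : ℝ) : ℝ :=
  sInf {y | ∃ h : ℝ → ℝ, ConcaveOn ℝ (Icc 0 1) h ∧ (∀ r ∈ Icc (0 : ℝ) 1, f r ≤ h r) ∧ h s = y}

namespace Profile

/-- `Q` encodes the non-increasing left-continuous step function `σ̄` with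
`hat J_{σ²} = J_{σ̄²}` on `[0, 1]`.  As consecutive values of `Q.σ` differ, the interior scales of
`Q` are exactly the points where `σ̄` jumps, so `Q.lam = (λ^0, …, λ^m)` and
`Q.σ = (σ̄_1, …, σ̄_m)`. -/
def IsEffective (P Q : Profile) : Prop :=
  StrictAnti Q.σ ∧ ∀ s ∈ Icc (0 : ℝ) 1, concaveHull P.J s = Q.J s

lemma step_eq (P : Profile) (i : Fin P.M) {s : ℝ}
    (hs : s ∈ Ioc (P.lam i.castSucc) (P.lam i.succ)) : P.step s = P.σ i := by
  have h0 : 0 ≤ P.lam i.castSucc := by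
    rw [← P.lam_zero]; exact P.lam_strictMono.monotone (Fin.zero_le _)
  have hs0 : s ≠ 0 := by have := hs.1; intro h; linarith
  unfold step
  rw [Set.indicator_of_notMem (by simpa using hs0), zero_add, Finset.sum_eq_single i]
  · exact Set.indicator_of_mem hs _
  · intro j _ hj
    apply Set.indicator_of_notMem
    intro hjs
    rcases lt_or_gt_of_ne hj with h | h
    · have : P.lam j.succ ≤ P.lam i.castSucc := P.lam_strictMono.monotone (by
        rw [Fin.le_def]; simp; exact h)
      linarith [hjs.2, hs.1]
    · have : P.lam i.succ ≤ P.lam j.castSucc := P.lam_strictMono.monotone (by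
        rw [Fin.le_def]; simp; exact h)
      linarith [hjs.1, hs.2]
  · simp

lemma step_sq_measurable (P : Profile) : Measurable fun s => P.step s ^ 2 := by
  unfold step
  refine Measurable.pow_const (Measurable.add ?_ ?_) 2
  · exact measurable_const.indicator (measurableSet_singleton 0)
  · exact Finset.measurable_fun_sum _ fun i _ => measurable_const.indicator measurableSet_Ioc

lemma step_sq_intervalIntegrable (P : Profile) (a b : ℝ) :
    IntervalIntegrable (fun s => P.step s ^ 2) volume a b := by
  have hb : ∃ K, ∀ s, ‖P.step s ^ 2‖ ≤ K := by
    refine ⟨(|P.firstσ| + ∑ i, |P.σ i|) ^ 2, fun s => ?_⟩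
    rw [norm_pow]
    refine pow_le_pow_left₀ (norm_nonneg _) ?_ 2
    refine (norm_add_le _ _).trans (add_le_add ?_ ((norm_sum_le _ _).trans
      (Finset.sum_le_sum fun i _ => ?_)))
    · exact norm_indicator_le_norm_self (f := fun _ : ℝ => P.firstσ) s
    · exact norm_indicator_le_norm_self (f := fun _ : ℝ => P.σ i) s
  obtain ⟨K, hK⟩ := hb
  exact (intervalIntegrable_const (c := K)).mono_fun
    P.step_sq_measurable.aestronglyMeasurable (Filter.Eventually.of_forall fun s =>
      (hK s).trans (le_abs_self K))

/-- `J_{σ²}` is affine with slope `σ_i²` on `[λ_{i-1}, λ_i]`. -/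
lemma J_affine (P : Profile) (i : Fin P.M) {s : ℝ}
    (hs : s ∈ Icc (P.lam i.castSucc) (P.lam i.succ)) :
    P.J s = P.J (P.lam i.castSucc) + P.σ i ^ 2 * (s - P.lam i.castSucc) := by
  unfold J
  rw [← intervalIntegral.integral_add_adjacent_intervals
    (P.step_sq_intervalIntegrable 0 (P.lam i.castSucc)) (P.step_sq_intervalIntegrable _ s)]
  congr 1
  rw [intervalIntegral.integral_of_le hs.1,
    setIntegral_congr_fun (g := fun _ => P.σ i ^ 2) measurableSet_Ioc, ← intervalIntegral.integral_of_le hs.1]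
  · simp [mul_comm]
  · intro r hr
    simp only
    rw [P.step_eq i ⟨hr.1, hr.2.trans hs.2⟩]

lemma J_zero (P : Profile) : P.J 0 = 0 := by simp [J]

/-- Every point of `[0, 1]` lies in one of the intervals `[λ_{i-1}, λ_i]`. -/
lemma exists_interval (P : Profile) {s : ℝ} (hs : s ∈ Icc (0 : ℝ) 1) :
    ∃ i : Fin P.M, s ∈ Icc (P.lam i.castSucc) (P.lam i.succ) := by
  by_contra! hc
  have key : ∀ k : Fin (P.M + 1), P.lam k ≤ s := by
    intro k
    induction k using Fin.induction with
    | zero => rw [P.lam_zero]; exact hs.1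
    | succ i ih =>
      by_contra! h
      exact hc i ⟨ih, h.le⟩
  have hlast : (⟨P.M - 1, Nat.sub_lt P.M_pos one_pos⟩ : Fin P.M).succ = Fin.last P.M := by
    ext; simp; have := P.M_pos; omega
  refine hc ⟨P.M - 1, Nat.sub_lt P.M_pos one_pos⟩ ⟨key _, ?_⟩
  rw [hlast, P.lam_last]; exact hs.2

lemma lam_mem (P : Profile) (k : Fin (P.M + 1)) : P.lam k ∈ Icc (0 : ℝ) 1 := by
  constructor
  · rw [← P.lam_zero]; exact P.lam_strictMono.monotone (Fin.zero_le _)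
  · rw [← P.lam_last]; exact P.lam_strictMono.monotone (Fin.le_last _)

lemma J_lam_strictMono (P : Profile) : StrictMono fun k => P.J (P.lam k) := by
  rw [Fin.strictMono_iff_lt_succ]
  intro i
  have hlt : P.lam i.castSucc < P.lam i.succ := P.lam_strictMono (by simp [Fin.lt_def])
  show P.J _ < P.J _
  rw [P.J_affine i (right_mem_Icc.2 hlt.le)]
  have := P.σ_pos i
  have : 0 < P.σ i ^ 2 * (P.lam i.succ - P.lam i.castSucc) :=
    mul_pos (by positivity) (by linarith)
  linarith

/-- The greedy construction of the concave polygon above the points of index `≥ k`. -/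
lemma exists_polygon (P : Profile) (k : Fin (P.M + 1)) (hk : k < Fin.last P.M) :
    ∃ (m : ℕ) (L : Fin (m + 2) → Fin (P.M + 1)) (c : Fin (m + 1) → ℝ),
      StrictMono L ∧ L 0 = k ∧ L (Fin.last (m + 1)) = Fin.last P.M ∧ (∀ j, 0 < c j) ∧
      StrictAnti c ∧
      (∀ j, P.J (P.lam (L j.succ)) - P.J (P.lam (L j.castSucc)) =
        c j ^ 2 * (P.lam (L j.succ) - P.lam (L j.castSucc))) ∧
      (∀ j i, k ≤ i → P.J (P.lam i) ≤
        P.J (P.lam (L j.castSucc)) + c j ^ 2 * (P.lam i - P.lam (L j.castSucc))) := by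
  induction hd : P.M - k.1 using Nat.strong_induction_on generalizing k with
  | _ d ih =>
  set F : Fin (P.M + 1) → ℝ := fun i => P.J (P.lam i) with hF
  have hlam := P.lam_strictMono
  let sl : Fin (P.M + 1) → ℝ := fun i => (F i - F k) / (P.lam i - P.lam k)
  have hsl : ∀ i, k < i → F i - F k = sl i * (P.lam i - P.lam k) := fun i hi => by
    have := hlam hi
    simp only [sl]; rw [div_mul_cancel₀]; linarith
  obtain ⟨b0, hb0, hmax0⟩ := Finset.exists_max_image (Finset.Ioi k) sl ⟨_, Finset.mem_Ioi.2 hk⟩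
  let T := (Finset.Ioi k).filter fun i => sl i = sl b0
  have hT : T.Nonempty := ⟨b0, by simp [T]; simpa using hb0⟩
  obtain ⟨b, hbT, hbmax⟩ := Finset.exists_max_image T id hT
  have hkb : k < b := by
    have := (Finset.mem_filter.1 hbT).1
    simpa using this
  have hslb : sl b = sl b0 := (Finset.mem_filter.1 hbT).2
  have hle : ∀ i, k < i → sl i ≤ sl b := fun i hi => by
    rw [hslb]; exact hmax0 i (by simpa using hi)
  have hlt : ∀ i, b < i → sl i < sl b := fun i hi => by
    refine lt_of_le_of_ne (hle i (hkb.trans hi)) fun h => ?_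
    have : i ≤ b := hbmax i (Finset.mem_filter.2 ⟨by simpa using hkb.trans hi, h.trans hslb⟩)
    exact absurd this (not_le.2 hi)
  have hpos : 0 < sl b := div_pos (sub_pos.2 (P.J_lam_strictMono hkb)) (sub_pos.2 (hlam hkb))
  have hsq : Real.sqrt (sl b) ^ 2 = sl b := Real.sq_sqrt hpos.le
  have hline : ∀ i, k ≤ i → F i ≤ F k + sl b * (P.lam i - P.lam k) := fun i hi => by
    rcases hi.eq_or_lt with rfl | hi
    · simp
    · have h1 := hsl i hi
      have h2 := mul_le_mul_of_nonneg_right (hle i hi) (sub_nonneg.2 (hlam hi).le)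
      linarith
  have hFb := hsl b hkb
  by_cases hbl : b = Fin.last P.M
  · refine ⟨0, ![k, b], ![Real.sqrt (sl b)], ?_, rfl, ?_, ?_, ?_, ?_, ?_⟩
    · rw [Fin.strictMono_iff_lt_succ]; intro i; fin_cases i; simpa using hkb
    · simpa using hbl
    · intro j; fin_cases j; simpa using hpos
    · intro i j hij; exact absurd hij (by fin_cases i; fin_cases j; simp)
    · intro j; fin_cases j; simpa [hsq] using hFb
    · intro j i hi; fin_cases j; simpa [hsq] using hline i hi
  · have hbl' : b < Fin.last P.M := lt_of_le_of_ne (Fin.le_last _) hbl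
    obtain ⟨m, L, c, hL, hL0, hLl, hc, hca, hseg, hmaj⟩ :=
      ih (P.M - b.1) (by have h1 := Fin.lt_def.1 hkb; have h2 := Fin.lt_def.1 hk
                         simp at h2; omega) b hbl' rfl
    have hc0 : c 0 ^ 2 < sl b := by
      have hbL : b < L (Fin.succ 0) := by
        rw [← hL0]; exact hL (by simp)
      have h1 := hseg 0
      rw [Fin.castSucc_zero, hL0] at h1
      have h2 := hsl _ (hkb.trans hbL)
      have h3 := mul_lt_mul_of_pos_right (hlt _ hbL) (sub_pos.2 (hlam (hkb.trans hbL)))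
      have h4 := sub_pos.2 (hlam hbL)
      have h5 : c 0 ^ 2 * (P.lam (L (Fin.succ 0)) - P.lam b) <
          sl b * (P.lam (L (Fin.succ 0)) - P.lam b) := by
        simp only [hF] at h2 hFb
        linarith
      exact lt_of_mul_lt_mul_right h5 h4.le
    have hcj : ∀ j, c j ^ 2 < sl b := fun j => by
      refine lt_of_le_of_lt ?_ hc0
      exact pow_le_pow_left₀ (hc j).le (hca.antitone (Fin.zero_le j)) 2
    refine ⟨m + 1, Fin.cons k L, Fin.cons (Real.sqrt (sl b)) c, ?_, rfl, ?_, ?_, ?_, ?_, ?_⟩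
    · rw [Fin.strictMono_iff_lt_succ]
      intro i
      refine Fin.cases ?_ (fun i => ?_) i
      · simpa [hL0] using hkb
      · rw [Fin.castSucc_succ]
        simp only [Fin.cons_succ]
        exact hL (by simp [Fin.lt_def])
    · rw [← Fin.succ_last, Fin.cons_succ]; exact hLl
    · intro j
      refine Fin.cases ?_ (fun j => ?_) j
      · simpa using hpos
      · simpa using hc j
    · rw [Fin.strictAnti_iff_succ_lt]
      intro i
      refine Fin.cases ?_ (fun i => ?_) i
      · simp only [Fin.castSucc_zero, Fin.cons_zero, Fin.cons_succ]
        exact Real.lt_sqrt_of_sq_lt hc0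
      · rw [Fin.castSucc_succ]
        simp only [Fin.cons_succ]
        exact hca (by simp [Fin.lt_def])
    · intro j
      refine Fin.cases ?_ (fun j => ?_) j
      · simpa [hsq, hL0] using hFb
      · rw [Fin.castSucc_succ]
        simp only [Fin.cons_succ]
        exact hseg j
    · intro j i hi
      refine Fin.cases ?_ (fun j => ?_) j
      · simpa [hsq] using hline i hi
      · rw [Fin.castSucc_succ]
        simp only [Fin.cons_succ]
        rcases le_or_gt b i with hbi | hib
        · exact hmaj j i hbi
        · have h1 := hline i hi
          have h2 := hmaj j b le_rfl
          have h3 := mul_le_mul_of_nonneg_right (hcj j).le (sub_nonneg.2 (hlam hib).le)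
          simp only [hF] at h1 hFb
          linarith

/-- Existence of `σ̄`. -/
theorem exists_isEffective (P : Profile) : ∃ Q : Profile, P.IsEffective Q := by
  have h0l : (0 : Fin (P.M + 1)) < Fin.last P.M := by
    simp [Fin.lt_def]; exact P.M_pos
  obtain ⟨m, L, c, hL, hL0, hLl, hc, hca, hseg, hmaj⟩ := P.exists_polygon 0 h0l
  let Q : Profile :=
    { M := m + 1
      M_pos := m.succ_pos
      σ := c
      σ_pos := hc
      lam := fun j => P.lam (L j)
      lam_strictMono := P.lam_strictMono.comp hL
      lam_zero := by rw [hL0, P.lam_zero]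
      lam_last := by rw [hLl, P.lam_last] }
  refine ⟨Q, hca, fun s hs => ?_⟩
  have hQJ : ∀ j : Fin (m + 2), Q.J (Q.lam j) = P.J (P.lam (L j)) := by
    intro j
    induction j using Fin.induction with
    | zero =>
      rw [hL0, P.lam_zero, P.J_zero]
      exact (congrArg Q.J Q.lam_zero).trans Q.J_zero
    | succ i ih =>
      have h1 := Q.J_affine i (right_mem_Icc.2 (Q.lam_strictMono.monotone
        (Fin.castSucc_lt_succ (i := i)).le))
      have h2 := hseg i
      rw [h1, ih]
      show _ + c i ^ 2 * (P.lam (L i.succ) - P.lam (L i.castSucc)) = _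
      linarith
  obtain ⟨j, hj⟩ := Q.exists_interval hs
  have hjs := Q.J_affine j hj
  have hval : Q.J s = P.J (P.lam (L j.castSucc)) + c j ^ 2 * (s - P.lam (L j.castSucc)) := by
    rw [hjs, hQJ]
  -- every line dominates `J` on the whole of `[0, 1]`
  have hdom : ∀ r ∈ Icc (0 : ℝ) 1,
      P.J r ≤ P.J (P.lam (L j.castSucc)) + c j ^ 2 * (r - P.lam (L j.castSucc)) := by
    intro r hr
    obtain ⟨i, hi⟩ := P.exists_interval hr
    have e1 := P.J_affine i hi
    have hlt : P.lam i.castSucc < P.lam i.succ :=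
      P.lam_strictMono (Fin.castSucc_lt_succ (i := i))
    have e2 := P.J_affine i (right_mem_Icc.2 hlt.le)
    have b1 := hmaj j i.castSucc (Fin.zero_le _)
    have b2 := hmaj j i.succ (Fin.zero_le _)
    rcases le_total (P.σ i ^ 2) (c j ^ 2) with h | h
    · have := mul_le_mul_of_nonneg_right h (sub_nonneg.2 hi.1)
      linarith
    · have := mul_le_mul_of_nonneg_right h (sub_nonneg.2 hi.2)
      linarith
  rw [hval]
  refine IsLeast.csInf_eq ⟨⟨fun r => P.J (P.lam (L j.castSucc)) +
    c j ^ 2 * (r - P.lam (L j.castSucc)), ?_, hdom, rfl⟩, ?_⟩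
  · refine ⟨convex_Icc 0 1, fun x _ y _ a b _ _ hab => le_of_eq ?_⟩
    simp only [smul_eq_mul]
    obtain rfl : b = 1 - a := by linarith
    ring
  · rintro y ⟨h, hcv, hh, rfl⟩
    have hlt : P.lam (L j.castSucc) < P.lam (L j.succ) :=
      P.lam_strictMono (hL (Fin.castSucc_lt_succ (i := j)))
    have hjl : P.lam (L j.castSucc) ≤ s := hj.1
    have hjr : s ≤ P.lam (L j.succ) := hj.2
    set u := P.lam (L j.castSucc) with hu
    set w := P.lam (L j.succ) with hw
    have hwu : 0 < w - u := by linarith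
    have k1 := hh u (P.lam_mem _)
    have k2 := hh w (P.lam_mem _)
    have k3 : ((w - s) / (w - u)) • h u + ((s - u) / (w - u)) • h w ≤
        h (((w - s) / (w - u)) • u + ((s - u) / (w - u)) • w) :=
      hcv.2 (P.lam_mem (L j.castSucc)) (P.lam_mem (L j.succ))
        (div_nonneg (by linarith) hwu.le) (div_nonneg (by linarith) hwu.le)
        (by field_simp; ring)
    have k4 : ((w - s) / (w - u)) • u + ((s - u) / (w - u)) • w = s := by
      simp only [smul_eq_mul]; field_simp; ring
    rw [k4] at k3
    simp only [smul_eq_mul] at k3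
    refine le_trans ?_ k3
    have k5 := hseg j
    rw [← hu, ← hw] at k5
    have k6 := mul_le_mul_of_nonneg_left k1 (div_nonneg (sub_nonneg.2 hjr) hwu.le)
    have k7 := mul_le_mul_of_nonneg_left k2 (div_nonneg (sub_nonneg.2 hjl) hwu.le)
    refine le_trans (le_of_eq ?_) (add_le_add k6 k7)
    have k8 : P.J w = P.J u + c j ^ 2 * (w - u) := by linarith
    rw [k8]
    field_simp
    ring

/-- The effective parameters: `P.eff.M = m`, `P.eff.lam = (λ^0, …, λ^m)`,
`P.eff.σ = (σ̄_1, …, σ̄_m)`.  They are uniquely determined by `IsEffective`. -/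
def eff (P : Profile) : Profile := P.exists_isEffective.choose

theorem eff_spec (P : Profile) : P.IsEffective P.eff := P.exists_isEffective.choose_spec

/-- `J_{σ²}` and `J_{σ̄²}` coincide on `[a, b]`. -/
def Coincide (P : Profile) (a b : ℝ) : Prop := ∀ s ∈ Icc a b, P.J s = P.eff.J s

/-- The restriction: if `J_{σ²}` and `J_{σ̄²}` coincide on some (nondegenerate) subinterval of
`[λ^{j-1}, λ^j]`, then they coincide on the whole of `[λ^{j-1}, λ^j]`. -/
def Restricted (P : Profile) : Prop :=
  ∀ j : Fin P.eff.M,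
    (∃ a b : ℝ, P.eff.lam j.castSucc ≤ a ∧ a < b ∧ b ≤ P.eff.lam j.succ ∧ P.Coincide a b) →
      P.Coincide (P.eff.lam j.castSucc) (P.eff.lam j.succ)

open Classical in
/-- `δ_j = 1` if `J_{σ²}` and `J_{σ̄²}` coincide on `[λ^{j-1}, λ^j]`, and `0` otherwise. -/
def δ (P : Profile) (j : Fin P.eff.M) : ℕ :=
  if P.Coincide (P.eff.lam j.castSucc) (P.eff.lam j.succ) then 1 else 0

/-- The effective times `t^j = λ^j n`. -/
def effTime (P : Profile) (n : ℕ) (j : Fin (P.eff.M + 1)) : ℝ := P.eff.lam j * n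

/-- `∇t^j = t^j - t^{j-1}`. -/
def gapTime (P : Profile) (n : ℕ) (j : Fin P.eff.M) : ℝ :=
  P.effTime n j.succ - P.effTime n j.castSucc

end Profile

/-- `g = √(2 log 2)`. -/
def g : ℝ := Real.sqrt (2 * Real.log 2)

namespace Profile

open Classical in
/-- The path `M_n^⋆(k)`.  The indices `j ≤ ϑ_k`, where `t^{ϑ_k - 1} < k ≤ t^{ϑ_k}`, are those with
`t^{j-1} < k`. -/
def optimalPath (P : Profile) (n k : ℕ) : ℝ :=
  ∑ j ∈ Finset.univ.filter (fun j : Fin P.eff.M => P.effTime n j.castSucc < k),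
    (min (k : ℝ) (P.effTime n j.succ) - P.effTime n j.castSucc) / P.gapTime n j *
      (g * P.eff.σ j * P.gapTime n j -
        (1 + 2 * (P.δ j : ℝ)) * P.eff.σ j / (2 * g) * Real.log (P.gapTime n j))

end Profile

/-- The particles at time `k` of the binary tree: the set `D_k`, with `2 ^ k` elements. -/
abbrev Particle (k : ℕ) : Type := Fin k → Bool

/-- The ancestor `v_k` at time `k ≤ n` of the particle `v` at time `n`. -/
def ancestor {n : ℕ} (v : Particle n) (k : ℕ) (hk : k ≤ n) : Particle k :=
  fun i => v (Fin.castLE hk i)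

/-- All particles living at one of the times `1, …, n`; `⟨k, w⟩` is a particle `w` at time
`k + 1`. -/
abbrev Vertex (n : ℕ) : Type := Σ k : Fin n, Particle (k + 1)

/-- The `(σ, λ)`-BRW of length `n` driven by `Z`:
`S_v(t) = ∑_{i=1}^M ∑_{k = ⌊λ_{i-1} n⌋ + 1}^{⌊λ_i n⌋ ∧ t} σ_i Z_{v_k}`
(the inner index `k : Fin n` stands for the time `k + 1`). -/
def walk (P : Profile) {n : ℕ} {Ω : Type*} (Z : Vertex n → Ω → ℝ) (v : Particle n) (t : ℕ)
    (ω : Ω) : ℝ :=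
  ∑ i : Fin P.M,
    ∑ k ∈ Finset.univ.filter (fun k : Fin n =>
        ⌊P.lam i.castSucc * n⌋₊ + 1 ≤ (k : ℕ) + 1 ∧
          (k : ℕ) + 1 ≤ min ⌊P.lam i.succ * n⌋₊ t),
      P.σ i * Z ⟨k, ancestor v (k + 1) k.isLt⟩ ω

/-- `max_{v ∈ D_n} S_v` with `S_v = S_v(n)`. -/
def maxWalk (P : Profile) {n : ℕ} {Ω : Type*} (Z : Vertex n → Ω → ℝ) (ω : Ω) : ℝ :=
  Finset.univ.sup' Finset.univ_nonempty fun v : Particle n => walk P Z v n ω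

end BRW

end

open scoped ENNReal NNReal

namespace BRW

/-! ### Gaussian integrals -/

/-! Let `u` be the probability that some descendant of a particle at position `s` ends in the target
half-line. Summing over the two children gives `u ≤ 2 𝔼[min 1 u']`, with `u'` the same probability
one generation later. This is `branchStep`, and iterating it bounds the tail of the maximum
(`measure_exists_endpoint_le`). Keeping the truncation `min 1` in every generation replaces an
explicit barrier event: beyond the barrier the value `1` is used, and below it the first moment.

The generations are split at the effective scales and treated from the last stretch back to the
first. If the terminal value on stretch `j` is at most `C exp(ρ(s - β))` with `ρ` above the critical
rate `g/σ̄_j`, then its value at the start of the stretch decays at exactly the critical rate in the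
distance `y` from the centring (`exists_stretch_le`).

For `δ_j = 0` only the total variance matters: it is `σ̄_j²` per generation up to a bounded error,
because the concave hull touches `J` at the effective scales. Tilting by `g/σ̄_j` makes the expected
number of particles at the centring height critical. The surplus in `ρ` localises the endpoint, so
the Gaussian density supplies the factor `N^(-1/2)` (`exists_foldr_le_of_sum_le`).

For `δ_j = 1` all steps have size `σ̄_j`. Relative to a logarithmic barrier, the tilted recursion is
a Gaussian walk killed at `0`, plus a source of order `m^(-3/2)` for crossing the barrier with `m`
generations left. A killed walk that must end near `0` after `k` steps costs `y k^(-3/2)`: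
`k^(-1/2)` each for survival at the start, for the density in the middle, and for survival of the
reversed walk (`exists_killIter_exp_le`). The convolution of two sequences `k^(-3/2)` is again of
that order, which gives `y exp(-g y)` (`exists_foldr_replicate_le`).

The critical rates `g/σ̄_j` increase strictly in `j`, so each later stretch can give up a little of
its rate and still exceed the preceding critical rate. This absorbs its linear factor
(`exists_stretches_le`). Only the first stretch is kept sharp, and it produces the rate `g/σ̄_1`. -/

lemma measurable_lintegral_gaussianReal {f : ℝ → ℝ≥0∞} (hf : Measurable f) (v : ℝ≥0) :
    Measurable fun s => ∫⁻ u, f u ∂gaussianReal s v :=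
  (Measure.measurable_lintegral hf).comp
    (measurable_gaussianReal.comp (measurable_id.prodMk measurable_const))

lemma lintegral_gaussianReal_shift {f : ℝ → ℝ≥0∞} (hf : Measurable f) (s : ℝ) (v : ℝ≥0) :
    ∫⁻ u, f u ∂gaussianReal s v = ∫⁻ ξ, f (s + ξ) ∂gaussianReal 0 v := by
  have h := gaussianReal_map_const_add (μ := 0) (v := v) s
  rw [zero_add] at h
  rw [← h, lintegral_map hf (by fun_prop)]

lemma lintegral_gaussianReal_affine {f : ℝ → ℝ≥0∞} (hf : Measurable f) (a b m : ℝ) {v w : ℝ≥0}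
    (hw : (w : ℝ) = b ^ 2 * v) :
    ∫⁻ u, f (a + b * u) ∂gaussianReal m v = ∫⁻ u, f u ∂gaussianReal (a + b * m) w := by
  obtain rfl : w = NNReal.mk (b ^ 2) (sq_nonneg b) * v := NNReal.eq hw
  have h1 : ∫⁻ u, f (a + b * u) ∂gaussianReal m v =
      ∫⁻ u, f (a + u) ∂((gaussianReal m v).map (b * ·)) := by
    rw [lintegral_map (by fun_prop) (by fun_prop)]
  have h2 := gaussianReal_map_const_add (μ := b * m)
    (v := NNReal.mk (b ^ 2) (sq_nonneg b) * v) a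
  rw [h1, gaussianReal_map_const_mul, add_comm a, ← h2, lintegral_map hf (by fun_prop)]

/-- The Chapman–Kolmogorov identity for Gaussian transition kernels. -/
lemma lintegral_lintegral_gaussianReal {f : ℝ → ℝ≥0∞} (hf : Measurable f) (s : ℝ) (v w : ℝ≥0) :
    ∫⁻ u, ∫⁻ r, f r ∂gaussianReal u w ∂gaussianReal s v = ∫⁻ r, f r ∂gaussianReal s (v + w) := by
  have h := gaussianReal_conv_gaussianReal (m₁ := s) (m₂ := 0) (v₁ := v) (v₂ := w)
  rw [add_zero] at h
  rw [← h, Measure.lintegral_conv hf]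
  exact lintegral_congr fun u => lintegral_gaussianReal_shift hf u w

/-- The exponential change of measure. -/
lemma lintegral_exp_mul_gaussianReal {f : ℝ → ℝ≥0∞} (hf : Measurable f) (t m : ℝ) (v : ℝ≥0) :
    ∫⁻ u, ENNReal.ofReal (Real.exp (t * u)) * f u ∂gaussianReal m v =
      ENNReal.ofReal (Real.exp (t * m + t ^ 2 * v / 2)) *
        ∫⁻ u, f u ∂gaussianReal (m + t * v) v := by
  rcases eq_or_ne v 0 with rfl | hv
  · simp [gaussianReal_zero_var, lintegral_dirac' _ hf,
      lintegral_dirac' m (show Measurable fun u : ℝ => ENNReal.ofReal (Real.exp (t * u)) * f u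
        by fun_prop)]
  rw [gaussianReal_of_var_ne_zero _ hv, gaussianReal_of_var_ne_zero _ hv,
    lintegral_withDensity_eq_lintegral_mul _ (measurable_gaussianPDF _ _) (by fun_prop),
    lintegral_withDensity_eq_lintegral_mul _ (measurable_gaussianPDF _ _) hf,
    ← lintegral_const_mul _ ((measurable_gaussianPDF _ _).mul hf)]
  refine lintegral_congr fun u => ?_
  simp only [Pi.mul_apply, gaussianPDF, ← mul_assoc]
  rw [← ENNReal.ofReal_mul (gaussianPDFReal_nonneg _ _ _), ← ENNReal.ofReal_mul (Real.exp_nonneg _)]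
  congr 2
  unfold gaussianPDFReal
  have hv' : (v : ℝ) ≠ 0 := by exact_mod_cast hv
  rw [mul_assoc, ← Real.exp_add, mul_left_comm, ← Real.exp_add]
  congr 2
  field_simp
  ring

lemma gaussianPDFReal_le (m : ℝ) (v : ℝ≥0) (x : ℝ) :
    gaussianPDFReal m v x ≤ (√(2 * Real.pi * v))⁻¹ := by
  unfold gaussianPDFReal
  refine mul_le_of_le_one_right (by positivity) (Real.exp_le_one_iff.2 ?_)
  exact div_nonpos_of_nonpos_of_nonneg (by nlinarith [sq_nonneg (x - m)]) (by positivity)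

lemma lintegral_gaussianReal_le {f : ℝ → ℝ≥0∞} (hf : Measurable f) (m : ℝ) {v : ℝ≥0}
    (hv : v ≠ 0) :
    ∫⁻ u, f u ∂gaussianReal m v ≤ ENNReal.ofReal (√(2 * Real.pi * v))⁻¹ * ∫⁻ u, f u := by
  rw [gaussianReal_of_var_ne_zero _ hv,
    lintegral_withDensity_eq_lintegral_mul _ (measurable_gaussianPDF _ _) hf,
    ← lintegral_const_mul _ hf]
  refine lintegral_mono fun u => ?_
  simp only [Pi.mul_apply, gaussianPDF]
  gcongr
  exact gaussianPDFReal_le _ _ _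

/-! ### The branching recursion -/

/-- One branching step: twice the Gaussian average of the truncated function `min 1 f`. -/
noncomputable def branchStep (v : ℝ≥0) (f : ℝ → ℝ≥0∞) (s : ℝ) : ℝ≥0∞ :=
  2 * ∫⁻ u, min 1 (f u) ∂gaussianReal s v

lemma measurable_branchStep {f : ℝ → ℝ≥0∞} (hf : Measurable f) (v : ℝ≥0) :
    Measurable (branchStep v f) :=
  (measurable_lintegral_gaussianReal (measurable_const.min hf) v).const_mul _

lemma measurable_foldr_branchStep {f : ℝ → ℝ≥0∞} (hf : Measurable f) (l : List ℝ≥0) :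
    Measurable (l.foldr branchStep f) := by
  induction l with
  | nil => exact hf
  | cons v l ih => exact measurable_branchStep ih v

lemma branchStep_mono {f h : ℝ → ℝ≥0∞} (hfh : ∀ s, min 1 (f s) ≤ min 1 (h s)) (v : ℝ≥0) (s : ℝ) :
    branchStep v f s ≤ branchStep v h s := by
  unfold branchStep
  exact mul_le_mul_right (lintegral_mono hfh) 2

/-- Each branching step reads its argument only through `min 1`, so a bound on the truncation of the
terminal function suffices. The outer truncations cover the empty list, where no step has been taken
yet. -/
lemma min_foldr_branchStep_mono {f h : ℝ → ℝ≥0∞} (hfh : ∀ s, min 1 (f s) ≤ min 1 (h s))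
    (l : List ℝ≥0) (s : ℝ) :
    min 1 (l.foldr branchStep f s) ≤ min 1 (l.foldr branchStep h s) := by
  induction l generalizing s with
  | nil => exact hfh s
  | cons v l ih => exact min_le_min_left _ (branchStep_mono ih v s)

/-- The increments of the tree below the child `b` of the root. -/
def subtree {n : ℕ} {Ω : Type*} (Z : Vertex (n + 1) → Ω → ℝ) (b : Bool) (w : Vertex n) : Ω → ℝ :=
  Z ⟨w.1.succ, Fin.cons b w.2⟩

/-- The endpoint of the walk with step sizes `s` along the line of descent to `v`. -/
def endpoint {n : ℕ} (s : Fin n → ℝ) (z : Vertex n → ℝ) (v : Particle n) : ℝ :=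
  ∑ k, s k * z ⟨k, ancestor v (k + 1) k.isLt⟩

lemma endpoint_cons {n : ℕ} (s : Fin (n + 1) → ℝ) (z : Vertex (n + 1) → ℝ) (b : Bool)
    (v : Particle n) :
    endpoint s z (Fin.cons b v) = s 0 * z ⟨0, fun _ => b⟩ +
      endpoint (fun k => s k.succ) (fun w => z ⟨w.1.succ, Fin.cons b w.2⟩) v := by
  unfold endpoint
  rw [Fin.sum_univ_succ]
  congr 1
  · congr 3
    ext i
    obtain rfl : i = 0 := Fin.ext (by have := i.2; simp at this; simpa using this)
    rfl
  · refine Finset.sum_congr rfl fun k _ => ?_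
    congr 3
    ext i
    refine Fin.cases ?_ (fun i => ?_) i
    · rfl
    · rfl

lemma measurableSet_exists_endpoint {n : ℕ} (s : Fin n → ℝ) {A : Set ℝ} (hA : MeasurableSet A) :
    MeasurableSet {p : ℝ × (Vertex n → ℝ) | ∃ v : Particle n, p.1 + endpoint s p.2 v ∈ A} := by
  rw [Set.ofPred_exists]
  refine MeasurableSet.iUnion fun v => ?_
  refine (show Measurable fun p : ℝ × (Vertex n → ℝ) => p.1 + endpoint s p.2 v from ?_) hA
  unfold endpoint
  fun_prop

/-- The first moment bound, one generation at a time. -/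
theorem measure_exists_endpoint_le {A : Set ℝ} (hA : MeasurableSet A) {Ω : Type*}
    [MeasurableSpace Ω] (μ : Measure Ω) [IsProbabilityMeasure μ] (n : ℕ) (s : Fin n → ℝ)
    (Z : Vertex n → Ω → ℝ) (hlaw : ∀ w, HasLaw (Z w) (gaussianReal 0 1) μ) (hind : iIndepFun Z μ)
    (u : ℝ) :
    μ {ω | ∃ v : Particle n, u + endpoint s (fun w => Z w ω) v ∈ A} ≤
      (List.ofFn fun k => Real.toNNReal (s k ^ 2)).foldr branchStep (A.indicator 1) u := by
  induction n generalizing u with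
  | zero =>
    by_cases hu : u ∈ A
    · simp [hu, prob_le_one]
    · simp [hu, endpoint]
  | succ n ih =>
    set G := (List.ofFn fun k : Fin n => Real.toNNReal (s k.succ ^ 2)).foldr branchStep
      (A.indicator 1) with hG
    have hGm : Measurable G := measurable_foldr_branchStep (measurable_one.indicator hA) _
    have hae : ∀ w, AEMeasurable (Z w) μ := fun w => (hlaw w).aemeasurable
    have hsub : ∀ b, iIndepFun (subtree Z b) μ := fun b => by
      refine hind.precomp (g := fun w : Vertex n => (⟨w.1.succ, Fin.cons b w.2⟩ : Vertex (n + 1))) ?_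
      rintro ⟨k, w⟩ ⟨k', w'⟩ h
      obtain ⟨h1, h2⟩ := Sigma.mk.inj_iff.1 h
      obtain rfl := Fin.succ_injective _ h1
      obtain rfl := (Fin.cons_right_injective (α := fun _ => Bool) b) (eq_of_heq h2)
      rfl
    have key : ∀ b : Bool, μ {ω | ∃ v : Particle n, u + endpoint s (fun w => Z w ω)
        (Fin.cons b v) ∈ A} ≤ ∫⁻ a, min 1 (G a) ∂gaussianReal u (Real.toNNReal (s 0 ^ 2)) := by
      intro b
      -- The first edge and the edges of all later generations form disjoint index sets; `ψ` selects
      -- from the latter those below the child `b`.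
      have hI : IndepFun (Z ⟨0, fun _ => b⟩) (fun ω w => subtree Z b w ω) μ := by
        classical
        let S : Finset (Vertex (n + 1)) := {⟨0, fun _ => b⟩}
        let T : Finset (Vertex (n + 1)) := Finset.univ.filter fun w => w.1 ≠ 0
        have hST : Disjoint S T := by
          simp [S, T]
        have h := hind.indepFun_finset₀ S T hST hae
        let φ : (S → ℝ) → ℝ := fun f => f ⟨_, Finset.mem_singleton_self _⟩
        let ψ : (T → ℝ) → Vertex n → ℝ := fun f w =>
          f ⟨⟨w.1.succ, Fin.cons b w.2⟩, by simp [T]⟩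
        have hφ : Measurable φ := measurable_pi_apply _
        have hψ : Measurable ψ := measurable_pi_lambda _ fun w => measurable_pi_apply _
        exact h.comp hφ hψ
      have hsm : AEMeasurable (fun ω w => subtree Z b w ω) μ :=
        aemeasurable_pi_lambda _ fun w => hae _
      have hE := measurableSet_exists_endpoint (fun k : Fin n => s k.succ) hA
      have hφ : Measurable fun p : ℝ × (Vertex n → ℝ) => (u + s 0 * p.1, p.2) := by fun_prop
      have hset : {ω | ∃ v : Particle n, u + endpoint s (fun w => Z w ω) (Fin.cons b v) ∈ A} =
          (fun ω => (Z ⟨0, fun _ => b⟩ ω, fun w => subtree Z b w ω)) ⁻¹'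
            ((fun p : ℝ × (Vertex n → ℝ) => (u + s 0 * p.1, p.2)) ⁻¹'
              {p | ∃ v : Particle n, p.1 + endpoint (fun k : Fin n => s k.succ) p.2 v ∈ A}) := by
        ext ω
        simp only [Set.mem_ofPred_eq, mem_preimage, endpoint_cons, add_assoc]
        rfl
      rw [hset, ← Measure.map_apply_of_aemeasurable ((hae _).prodMk hsm) (hφ hE),
        hI.map_prod_eq_prod_map_map (hae _) hsm, (hlaw _).map_eq]
      have : SFinite (μ.map fun ω w => subtree Z b w ω) := inferInstance
      rw [Measure.prod_apply (hφ hE)]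
      have hle : ∀ a : ℝ, (μ.map fun ω w => subtree Z b w ω) (Prod.mk a ⁻¹'
          ((fun p : ℝ × (Vertex n → ℝ) => (u + s 0 * p.1, p.2)) ⁻¹'
              {p | ∃ v : Particle n, p.1 + endpoint (fun k : Fin n => s k.succ) p.2 v ∈ A})) ≤
          min 1 (G (u + s 0 * a)) := by
        intro a
        rw [Measure.map_apply_of_aemeasurable hsm (measurable_prodMk_left (hφ hE))]
        -- The truncation arises here: given the first increment, the remaining quantity is still a
        -- probability.
        refine le_min prob_le_one ?_
        exact ih (fun k => s k.succ) (subtree Z b) (fun w => hlaw _) (hsub b) (u + s 0 * a)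
      refine (lintegral_mono hle).trans (le_of_eq ?_)
      rw [lintegral_gaussianReal_affine (f := fun a => min 1 (G a)) (measurable_const.min hGm)
        (w := Real.toNNReal (s 0 ^ 2)) _ _ _ (by simp [sq_nonneg])]
      simp
    have hcover : {ω | ∃ v : Particle (n + 1), u + endpoint s (fun w => Z w ω) v ∈ A} ⊆
        {ω | ∃ v : Particle n, u + endpoint s (fun w => Z w ω) (Fin.cons true v) ∈ A} ∪
        {ω | ∃ v : Particle n, u + endpoint s (fun w => Z w ω) (Fin.cons false v) ∈ A} := by
      rintro ω ⟨v, hv⟩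
      rw [← Fin.cons_self_tail v] at hv
      cases h : v 0
      · right; rw [h] at hv; exact ⟨_, hv⟩
      · left; rw [h] at hv; exact ⟨_, hv⟩
    refine (measure_mono hcover).trans ((measure_union_le _ _).trans
      ((add_le_add (key true) (key false)).trans (le_of_eq ?_)))
    rw [List.ofFn_succ, List.foldr_cons, ← two_mul]
    rfl

/-! ### The Gaussian walk killed below the origin -/

/-- The transition operator of the walk with standard Gaussian steps and drift `d`, killed when it
leaves `(0, ∞)`. -/
noncomputable def kill (d : ℝ) (f : ℝ → ℝ≥0∞) (y : ℝ) : ℝ≥0∞ :=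
  ∫⁻ u in Ioi 0, f u ∂gaussianReal (y + d) 1

lemma kill_eq_indicator (d : ℝ) (f : ℝ → ℝ≥0∞) (y : ℝ) :
    kill d f y = ∫⁻ u, (Ioi 0).indicator f u ∂gaussianReal (y + d) 1 :=
  (lintegral_indicator measurableSet_Ioi f).symm

lemma measurable_kill {f : ℝ → ℝ≥0∞} (hf : Measurable f) (d : ℝ) : Measurable (kill d f) := by
  have h := (measurable_lintegral_gaussianReal (hf.indicator (measurableSet_Ioi (a := (0 : ℝ)))) 1).comp
    (measurable_id.add_const d)
  have h2 : kill d f = fun y => ∫⁻ u, (Ioi 0).indicator f u ∂gaussianReal (y + d) 1 :=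
    funext fun y => kill_eq_indicator d f y
  rw [h2]
  exact h

lemma kill_mono {f h : ℝ → ℝ≥0∞} (hfh : ∀ u, 0 < u → f u ≤ h u) (d y : ℝ) :
    kill d f y ≤ kill d h y :=
  setLIntegral_mono' measurableSet_Ioi hfh

lemma kill_const_mul {f : ℝ → ℝ≥0∞} (hf : Measurable f) (c : ℝ≥0∞) (d y : ℝ) :
    kill d (fun u => c * f u) y = c * kill d f y :=
  lintegral_const_mul c hf

lemma kill_le_kill {f : ℝ → ℝ≥0∞} (hf : Monotone f) (hm : Measurable f) {d d' y y' : ℝ}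
    (h : y + d ≤ y' + d') : kill d f y ≤ kill d' f y' := by
  have hi := hm.indicator (measurableSet_Ioi (a := (0 : ℝ)))
  rw [kill_eq_indicator, kill_eq_indicator, lintegral_gaussianReal_shift hi,
    lintegral_gaussianReal_shift hi]
  refine lintegral_mono fun ξ => ?_
  by_cases h0 : 0 < y + d + ξ
  · rw [indicator_of_mem (mem_Ioi.2 h0), indicator_of_mem (mem_Ioi.2 (by linarith))]
    exact hf (by linarith)
  · simp [indicator_of_notMem (show y + d + ξ ∉ Ioi (0 : ℝ) from h0)]

/-- `k` steps of the killed walk with drifts `d 0, …, d (k - 1)`. -/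
noncomputable def killIter (d : ℕ → ℝ) : ℕ → (ℝ → ℝ≥0∞) → ℝ → ℝ≥0∞
  | 0, f => f
  | k + 1, f => killIter d k (kill (d k) f)

lemma killIter_add (d : ℕ → ℝ) (a b : ℕ) (f : ℝ → ℝ≥0∞) :
    killIter d (a + b) f = killIter d a (killIter (fun i => d (a + i)) b f) := by
  induction b generalizing f with
  | zero => rfl
  | succ b ih => exact ih (kill (d (a + b)) f)

lemma killIter_succ' (d : ℕ → ℝ) (k : ℕ) (f : ℝ → ℝ≥0∞) :
    killIter d (k + 1) f = kill (d 0) (killIter (fun i => d (i + 1)) k f) := by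
  induction k generalizing f with
  | zero => rfl
  | succ k ih => exact ih (kill (d (k + 1)) f)

lemma measurable_killIter {f : ℝ → ℝ≥0∞} (hf : Measurable f) (d : ℕ → ℝ) (k : ℕ) :
    Measurable (killIter d k f) := by
  induction k generalizing f with
  | zero => exact hf
  | succ k ih => exact ih (measurable_kill hf _)

lemma killIter_mono {f h : ℝ → ℝ≥0∞} (hfh : ∀ u, 0 < u → f u ≤ h u) (d : ℕ → ℝ) (k : ℕ) {y : ℝ}
    (hy : 0 < y) : killIter d k f y ≤ killIter d k h y := by
  induction k generalizing f h with
  | zero => exact hfh y hy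
  | succ k ih => exact ih fun u _ => kill_mono hfh _ _

lemma killIter_const_mul {f : ℝ → ℝ≥0∞} (hf : Measurable f) (c : ℝ≥0∞) (d : ℕ → ℝ) (k : ℕ)
    (y : ℝ) : killIter d k (fun u => c * f u) y = c * killIter d k f y := by
  induction k generalizing f with
  | zero => rfl
  | succ k ih =>
    simp only [killIter]
    rw [← ih (measurable_kill hf _)]
    congr 1
    ext u
    exact kill_const_mul hf c _ _

lemma killIter_add_fun {f h : ℝ → ℝ≥0∞} (hf : Measurable f) (d : ℕ → ℝ) (k : ℕ)
    (y : ℝ) : killIter d k (fun u => f u + h u) y = killIter d k f y + killIter d k h y := by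
  induction k generalizing f h with
  | zero => rfl
  | succ k ih =>
    simp only [killIter]
    rw [← ih (measurable_kill hf _)]
    congr 1
    ext u
    exact lintegral_add_left hf _

/-- Coupling through the same noise: the walk with larger drifts stays above the other, hence
survives whenever the other does and ends higher. Killing preserves monotonicity of the payoff,
which lets the induction run. -/
lemma killIter_le_killIter {f : ℝ → ℝ≥0∞} (hf : Monotone f) (hm : Measurable f) {d d' : ℕ → ℝ}
    {k : ℕ} (h : ∀ i < k, d i ≤ d' i) {y : ℝ} (hy : 0 < y) :
    killIter d k f y ≤ killIter d' k f y := by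
  induction k generalizing f with
  | zero => exact le_rfl
  | succ k ih =>
    refine (ih (fun y y' h => kill_le_kill hf hm (by linarith)) (measurable_kill hm _)
      fun i hi => h i (hi.trans (Nat.lt_succ_self k))).trans ?_
    exact killIter_mono (fun u _ => kill_le_kill hf hm (by linarith [h k (Nat.lt_succ_self k)]))
      _ _ hy

/-! ### One-step supersolutions -/

lemma integrable_sq_gaussianReal (m : ℝ) (v : ℝ≥0) :
    Integrable (fun u : ℝ => u ^ 2) (gaussianReal m v) :=
  (memLp_id_gaussianReal (μ := m) (v := v) 2).integrable_sq

lemma integrable_id_gaussianReal (m : ℝ) (v : ℝ≥0) :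
    Integrable (fun u : ℝ => u) (gaussianReal m v) :=
  memLp_one_iff_integrable.1 (memLp_id_gaussianReal (μ := m) (v := v) 1)

lemma integrable_gaussianPDFReal_mul {f : ℝ → ℝ} {m : ℝ} {v : ℝ≥0} (hv : v ≠ 0)
    (hf : Integrable f (gaussianReal m v)) :
    Integrable (fun u => gaussianPDFReal m v u * f u) := by
  rw [gaussianReal_of_var_ne_zero _ hv, integrable_withDensity_iff_integrable_smul'
    (measurable_gaussianPDF _ _) (Filter.Eventually.of_forall fun _ => gaussianPDF_lt_top)] at hf
  simpa [toReal_gaussianPDF] using hf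

lemma setIntegral_gaussianReal {f : ℝ → ℝ} {m : ℝ} {v : ℝ≥0} (hv : v ≠ 0) {s : Set ℝ}
    (hs : MeasurableSet s) :
    ∫ u in s, f u ∂gaussianReal m v = ∫ u in s, gaussianPDFReal m v u * f u := by
  rw [← integral_indicator hs, integral_gaussianReal_eq_integral_smul hv, ← integral_indicator hs]
  refine integral_congr_ae (Filter.Eventually.of_forall fun u => ?_)
  by_cases h : u ∈ s <;> simp [h]

lemma hasDerivAt_gaussianPDFReal_one (z u : ℝ) :
    HasDerivAt (gaussianPDFReal z 1) (gaussianPDFReal z 1 u * (z - u)) u := by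
  unfold gaussianPDFReal
  have h : HasDerivAt (fun x : ℝ => -(x - z) ^ 2 / (2 * ((1 : ℝ≥0) : ℝ))) (z - u) u := by
    have h1 := ((((hasDerivAt_id u).sub_const z).pow 2).neg).div_const (2 * ((1 : ℝ≥0) : ℝ))
    refine h1.congr_deriv ?_
    simp
    ring
  refine (h.exp.const_mul _).congr_deriv ?_
  ring

/-- With `φ` the density of `N(z, 1)`, the derivative of `u φ(u)` is `φ(u) (1 - u² + z u)`, and `u
φ(u)` vanishes at `0` and `-∞`. Hence the integral equals `-z ∫ u φ` over the negative half-line,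
which is nonnegative. -/
lemma setIntegral_Iic_one_sub_sq_nonneg {z : ℝ} (hz : 0 ≤ z) :
    0 ≤ ∫ u in Iic 0, (1 - u ^ 2) ∂gaussianReal z 1 := by
  have h1 : Integrable (fun _ : ℝ => (1 : ℝ)) (gaussianReal z 1) := integrable_const 1
  have h2 := integrable_id_gaussianReal z 1
  have h3 := integrable_sq_gaussianReal z 1
  have h13 : Integrable (fun u : ℝ => 1 - u ^ 2) (gaussianReal z 1) := h1.sub h3
  have hd : ∀ u ∈ Iic (0 : ℝ), HasDerivAt (fun u => gaussianPDFReal z 1 u * u)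
      (gaussianPDFReal z 1 u * (1 - u ^ 2 + z * u)) u := fun u _ => by
    refine ((hasDerivAt_gaussianPDFReal_one z u).mul (hasDerivAt_id u)).congr_deriv ?_
    simp
    ring
  have hi := integrable_gaussianPDFReal_mul one_ne_zero (h13.add (h2.const_mul z))
  have hi0 := integrable_gaussianPDFReal_mul one_ne_zero h2
  have hz0 : ∫ u in Iic 0, gaussianPDFReal z 1 u * (1 - u ^ 2 + z * u) = 0 := by
    rw [integral_Iic_of_hasDerivAt_of_tendsto' hd hi.integrableOn
      (tendsto_zero_of_hasDerivAt_of_integrableOn_Iic hd hi.integrableOn hi0.integrableOn)]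
    simp
  rw [← setIntegral_gaussianReal one_ne_zero measurableSet_Iic, integral_add
    h13.integrableOn ((h2.const_mul z).integrableOn), integral_const_mul] at hz0
  have hneg : ∫ u in Iic 0, u ∂gaussianReal z 1 ≤ 0 :=
    setIntegral_nonpos measurableSet_Iic fun u hu => hu
  nlinarith [mul_nonneg hz (neg_nonneg.2 hneg)]

/-- Functions that are not too negative on `(-∞, 0]` lose no mass by killing. -/
lemma kill_ofReal_le {f : ℝ → ℝ} {κ d y : ℝ} (hκ : 0 ≤ κ) (hy : 0 ≤ y + d)
    (hf : Integrable f (gaussianReal (y + d) 1)) (hpos : ∀ u, 0 < u → 0 ≤ f u)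
    (hneg : ∀ u ≤ 0, κ * (1 - u ^ 2) ≤ f u) :
    kill d (fun u => ENNReal.ofReal (f u)) y ≤
      ENNReal.ofReal (∫ u, f u ∂gaussianReal (y + d) 1) := by
  have h1 : Integrable (fun u : ℝ => κ * (1 - u ^ 2)) (gaussianReal (y + d) 1) :=
    ((integrable_const 1).sub (integrable_sq_gaussianReal _ _)).const_mul κ
  have h2 : 0 ≤ ∫ u in Iic 0, f u ∂gaussianReal (y + d) 1 := by
    refine le_trans ?_ (setIntegral_mono_on h1.integrableOn hf.integrableOn measurableSet_Iic hneg)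
    rw [integral_const_mul]
    exact mul_nonneg hκ (setIntegral_Iic_one_sub_sq_nonneg hy)
  unfold kill
  rw [← ofReal_integral_eq_lintegral_ofReal hf.integrableOn
    ((ae_restrict_iff' measurableSet_Ioi).2 (Filter.Eventually.of_forall hpos))]
  refine ENNReal.ofReal_le_ofReal ?_
  have h3 := integral_add_compl (measurableSet_Iic (a := (0 : ℝ))) hf
  rw [compl_Iic] at h3
  linarith

/-- The shift by `2` pays for the overshoot below the origin: `u + 2 ≥ 1 - u²` everywhere because
`u² + u + 1 > 0`. So `u + 2` serves as a supersolution in place of the exact harmonic function. -/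
lemma kill_id_add_two_le {d y : ℝ} (hy : 0 ≤ y + d) :
    kill d (fun u => ENNReal.ofReal (u + 2)) y ≤ ENNReal.ofReal (y + d + 2) := by
  have hi := integrable_id_gaussianReal (y + d) 1
  have hi2 : Integrable (fun u : ℝ => u + 2) (gaussianReal (y + d) 1) := hi.add (integrable_const 2)
  refine (kill_ofReal_le zero_le_one hy hi2 (fun u hu => by linarith)
    fun u _ => by nlinarith [sq_nonneg (u + 1 / 2)]).trans (le_of_eq ?_)
  rw [integral_add hi (integrable_const 2), integral_id_gaussianReal]
  simp

/-! ### Survival of the driftless walk by comparison with the sign function under the heat flow -/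

/-- `𝔼 [sgn (s + √v N)]` for a standard Gaussian `N`. -/
noncomputable def gaussianSign (v : ℝ≥0) (s : ℝ) : ℝ :=
  (gaussianReal s v).real (Ici 0) - (gaussianReal s v).real (Iic 0)

lemma integrable_gaussianReal_real {A : Set ℝ} (hA : MeasurableSet A) (z : ℝ) (v w : ℝ≥0) :
    Integrable (fun u => (gaussianReal u v).real A) (gaussianReal z w) := by
  have hm : Measurable fun u => gaussianReal u v A := by
    simpa [lintegral_indicator hA] using measurable_lintegral_gaussianReal
      (measurable_one.indicator hA) v
  refine Integrable.of_bound (C := 1) hm.ennreal_toReal.aestronglyMeasurable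
    (Filter.Eventually.of_forall fun u => ?_)
  rw [Real.norm_of_nonneg measureReal_nonneg]
  exact measureReal_le_one

lemma integral_gaussianReal_real {A : Set ℝ} (hA : MeasurableSet A) (z : ℝ) (v w : ℝ≥0) :
    ∫ u, (gaussianReal u v).real A ∂gaussianReal z w = (gaussianReal z (w + v)).real A := by
  have hm : Measurable fun u => gaussianReal u v A := by
    simpa [lintegral_indicator hA] using measurable_lintegral_gaussianReal
      (measurable_one.indicator hA) v
  have h := lintegral_lintegral_gaussianReal (measurable_one.indicator hA) z w v
  simp only [lintegral_indicator_one hA] at h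
  unfold Measure.real
  rw [integral_toReal hm.aemeasurable (Filter.Eventually.of_forall fun u => measure_lt_top _ _), h]

lemma gaussianSign_eq_cdf (v : ℝ≥0) (s : ℝ) :
    gaussianSign v s = (gaussianReal 0 v).real (Iic s) - (gaussianReal 0 v).real (Iic (-s)) := by
  unfold gaussianSign
  have h1 := gaussianReal_map_const_sub (μ := 0) (v := v) s
  have h2 := gaussianReal_map_const_add (μ := 0) (v := v) s
  rw [sub_zero] at h1
  rw [zero_add] at h2
  congr 1
  · rw [← h1, map_measureReal_apply (by fun_prop) measurableSet_Ici]
    congr 1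
    ext x
    simp
  · rw [← h2, map_measureReal_apply (by fun_prop) measurableSet_Iic]
    congr 1
    ext x
    simp only [mem_preimage, mem_Iic]
    constructor <;> intro <;> linarith

lemma monotone_gaussianSign (v : ℝ≥0) : Monotone (gaussianSign v) := fun s s' h => by
  rw [gaussianSign_eq_cdf, gaussianSign_eq_cdf]
  exact sub_le_sub (measureReal_mono (Iic_subset_Iic.2 h))
    (measureReal_mono (Iic_subset_Iic.2 (neg_le_neg h)))

lemma gaussianSign_neg (v : ℝ≥0) (s : ℝ) : gaussianSign v (-s) = -gaussianSign v s := by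
  rw [gaussianSign_eq_cdf, gaussianSign_eq_cdf]
  simp

/-- `gaussianSign v s / s`. -/
noncomputable def gaussianSlope (v : ℝ≥0) (s : ℝ) : ℝ :=
  ∫ t in (-1 : ℝ)..1, gaussianPDFReal 0 v (s * t)

/-- The difference of distribution functions is the signed mass of `[-s, s]`, and `x = s t` rescales
this interval to `[-1, 1]`. -/
lemma gaussianSign_eq_mul {v : ℝ≥0} (hv : v ≠ 0) (s : ℝ) :
    gaussianSign v s = s * gaussianSlope v s := by
  have h : ∀ a, (gaussianReal 0 v).real (Iic a) = ∫ x in Iic a, gaussianPDFReal 0 v x := fun a => by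
    unfold Measure.real
    rw [gaussianReal_apply_eq_integral _ hv, ENNReal.toReal_ofReal]
    exact integral_nonneg fun x => gaussianPDFReal_nonneg _ _ _
  rw [gaussianSign_eq_cdf, h, h, intervalIntegral.integral_Iic_sub_Iic
    (integrable_gaussianPDFReal _ _).integrableOn (integrable_gaussianPDFReal _ _).integrableOn,
    gaussianSlope, intervalIntegral.mul_integral_comp_mul_left]
  simp

lemma continuous_gaussianPDFReal_mul (v : ℝ≥0) (s : ℝ) :
    Continuous fun t => gaussianPDFReal 0 v (s * t) := by
  unfold gaussianPDFReal
  fun_prop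

lemma gaussianSlope_nonneg (v : ℝ≥0) (s : ℝ) : 0 ≤ gaussianSlope v s :=
  intervalIntegral.integral_nonneg (by norm_num) fun _ _ => gaussianPDFReal_nonneg _ _ _

lemma gaussianSlope_anti (v : ℝ≥0) {s s' : ℝ} (h : |s| ≤ |s'|) :
    gaussianSlope v s' ≤ gaussianSlope v s := by
  refine intervalIntegral.integral_mono_on (by norm_num)
    ((continuous_gaussianPDFReal_mul v s').intervalIntegrable _ _)
    ((continuous_gaussianPDFReal_mul v s).intervalIntegrable _ _) fun t _ => ?_
  unfold gaussianPDFReal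
  have := mul_le_mul_of_nonneg_right (sq_le_sq.2 h) (sq_nonneg t)
  have h2 : -(s' * t - 0) ^ 2 ≤ -(s * t - 0) ^ 2 := by
    simp only [sub_zero, mul_pow]
    linarith
  gcongr

lemma gaussianSlope_le (v : ℝ≥0) (s : ℝ) : gaussianSlope v s ≤ (√v)⁻¹ := by
  have h := intervalIntegral.integral_mono_on (by norm_num : (-1 : ℝ) ≤ 1)
    ((continuous_gaussianPDFReal_mul v s).intervalIntegrable _ _)
    (intervalIntegrable_const (μ := volume)) fun t _ => gaussianPDFReal_le 0 v (s * t)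
  refine h.trans ?_
  rw [intervalIntegral.integral_const, Real.sqrt_mul (by positivity), mul_inv, smul_eq_mul,
    ← mul_assoc]
  refine mul_le_of_le_one_left (by positivity) ?_
  have : (2 : ℝ) ≤ √(2 * Real.pi) := Real.le_sqrt_of_sq_le (by nlinarith [Real.pi_gt_three])
  rw [← div_eq_mul_inv, div_le_one (by linarith)]
  linarith

/-- This is the condition of `kill_ofReal_le` for the shifted sign function. With `q = gaussianSlope
v 2`, the slope is at least `q` on `[-2, 2]` and at most `q` outside. This gives the lower bound `q
(u + 2)` for `u` in `[-2, 0]` and for `u ≤ -4`. In between, monotonicity and oddness give `-2 q`. -/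
lemma gaussianSign_add_two_ge {v : ℝ≥0} (hv : v ≠ 0) {u : ℝ} (hu : u ≤ 0) :
    gaussianSlope v 2 * (1 - u ^ 2) ≤ gaussianSign v (u + 2) := by
  have hq := gaussianSlope_nonneg v 2
  rcases le_total (-2) u with h | h
  · have h2 : gaussianSlope v 2 ≤ gaussianSlope v (u + 2) :=
      gaussianSlope_anti v (by rw [abs_of_nonneg (by linarith), abs_of_pos (by norm_num)]; linarith)
    rw [gaussianSign_eq_mul hv]
    nlinarith [mul_le_mul_of_nonneg_left h2 (show 0 ≤ u + 2 by linarith),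
      mul_nonneg hq (show 0 ≤ u ^ 2 + u + 1 by nlinarith [sq_nonneg (u + 1 / 2)])]
  · rcases le_total (-4) u with h4 | h4
    · have h2 := monotone_gaussianSign v (show (-2 : ℝ) ≤ u + 2 by linarith)
      rw [gaussianSign_neg, gaussianSign_eq_mul hv 2] at h2
      nlinarith [mul_nonneg hq (show 0 ≤ u ^ 2 - 3 by nlinarith)]
    · have h2 : gaussianSlope v (u + 2) ≤ gaussianSlope v 2 :=
        gaussianSlope_anti v (by
          rw [abs_of_nonpos (show u + 2 ≤ 0 by linarith), abs_of_pos (by norm_num)]; linarith)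
      rw [gaussianSign_eq_mul hv]
      nlinarith [mul_le_mul_of_nonneg_left h2 (show 0 ≤ -(u + 2) by linarith),
        mul_nonneg hq (show 0 ≤ u ^ 2 + u + 1 by nlinarith [sq_nonneg (u + 1 / 2)])]

lemma integrable_gaussianSign (v : ℝ≥0) (z : ℝ) :
    Integrable (fun u => gaussianSign v (u + 2)) (gaussianReal z 1) := by
  refine Integrable.of_bound (C := 1)
    ((monotone_gaussianSign v).measurable.comp (measurable_id.add_const 2)).aestronglyMeasurable
    (Filter.Eventually.of_forall fun u => ?_)
  rw [Real.norm_eq_abs, abs_le, gaussianSign]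
  have h1 := measureReal_le_one (μ := gaussianReal (u + 2) v) (s := Ici 0)
  have h2 := measureReal_le_one (μ := gaussianReal (u + 2) v) (s := Iic 0)
  have h3 := measureReal_nonneg (μ := gaussianReal (u + 2) v) (s := Ici 0)
  have h4 := measureReal_nonneg (μ := gaussianReal (u + 2) v) (s := Iic 0)
  constructor <;> linarith

/-- Chapman–Kolmogorov: a Gaussian step of variance `1` advances the heat flow by one unit, so
without killing the comparison functions reproduce themselves exactly. -/
lemma integral_gaussianSign (v : ℝ≥0) (z : ℝ) :
    ∫ u, gaussianSign v (u + 2) ∂gaussianReal z 1 = gaussianSign (1 + v) (z + 2) := by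
  have hm : Measurable (gaussianSign v) := (monotone_gaussianSign v).measurable
  have h : ∫ u, gaussianSign v (u + 2) ∂gaussianReal z 1 =
      ∫ u, gaussianSign v u ∂gaussianReal (z + 2) 1 := by
    rw [← gaussianReal_map_add_const 2, integral_map (by fun_prop) hm.aestronglyMeasurable]
  rw [h]
  unfold gaussianSign
  rw [integral_sub (integrable_gaussianReal_real measurableSet_Ici _ _ _)
    (integrable_gaussianReal_real measurableSet_Iic _ _ _),
    integral_gaussianReal_real measurableSet_Ici, integral_gaussianReal_real measurableSet_Iic]

lemma gaussianSign_one_two_pos : 0 < gaussianSign 1 2 := by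
  rw [gaussianSign_eq_mul one_ne_zero]
  refine mul_pos two_pos (intervalIntegral.intervalIntegral_pos_of_pos
    ((continuous_gaussianPDFReal_mul 1 2).intervalIntegrable _ _)
    (fun t => gaussianPDFReal_pos _ _ _ one_ne_zero) (by norm_num))

/-- Survival of the driftless walk. -/
theorem exists_survival_le : ∃ A : ℝ, 0 < A ∧ ∀ (k : ℕ) (y : ℝ), 0 < y →
    killIter (fun _ => 0) k 1 y ≤ ENNReal.ofReal (A * (y + 2) / √(k + 1)) := by
  have hp := gaussianSign_one_two_pos
  -- The extra unit of variance makes the comparison function smooth already at `k = 0`, and the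
  -- factor `(gaussianSign 1 2)⁻¹` makes it at least `1` for every `y > 0` there.
  have key : ∀ (k : ℕ) (y : ℝ), 0 < y → killIter (fun _ => 0) k 1 y ≤
      ENNReal.ofReal ((gaussianSign 1 2)⁻¹ * gaussianSign (k + 1) (y + 2)) := by
    intro k
    induction k with
    | zero =>
      intro y hy
      have : gaussianSign 1 2 ≤ gaussianSign 1 (y + 2) := monotone_gaussianSign 1 (by linarith)
      have h1 : 1 ≤ (gaussianSign 1 2)⁻¹ * gaussianSign 1 (y + 2) := by
        rw [← div_eq_inv_mul, one_le_div hp]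
        exact this
      simpa [killIter] using ENNReal.ofReal_le_ofReal h1
    | succ k ih =>
      intro y hy
      rw [killIter_succ']
      have hq := gaussianSlope_nonneg (k + 1) 2
      refine (kill_mono ih 0 y).trans ((kill_ofReal_le (κ := (gaussianSign 1 2)⁻¹ *
        gaussianSlope (k + 1) 2) (by positivity) (by linarith)
        ((integrable_gaussianSign _ _).const_mul _) (fun u hu => ?_) fun u hu => ?_).trans ?_)
      · have h := monotone_gaussianSign (k + 1) (show (2 : ℝ) ≤ u + 2 by linarith)
        rw [gaussianSign_eq_mul (by positivity) 2] at h
        exact mul_nonneg (by positivity) ((by positivity : (0 : ℝ) ≤ _).trans h)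
      · rw [mul_assoc]
        exact mul_le_mul_of_nonneg_left (gaussianSign_add_two_ge (by positivity) hu) (by positivity)
      · rw [integral_const_mul, integral_gaussianSign, add_zero, add_comm (1 : ℝ≥0)]
        push_cast
        rfl
  refine ⟨(gaussianSign 1 2)⁻¹, by positivity, fun k y hy => (key k y hy).trans ?_⟩
  refine ENNReal.ofReal_le_ofReal ?_
  rw [gaussianSign_eq_mul (v := k + 1) (by positivity), mul_div_assoc]
  have h := gaussianSlope_le (k + 1) (y + 2)
  push_cast at h
  rw [div_eq_mul_inv]
  exact mul_le_mul_of_nonneg_left (mul_le_mul_of_nonneg_left h (by linarith)) (by positivity)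

/-! ### Survival with a harmonic drift -/

/-- Moving an upward shift from after the test for positivity to before it only enlarges the
surviving event. -/
lemma kill_comp_add_le {h : ℝ → ℝ≥0∞} (hm : Measurable h) {a : ℝ} (ha : 0 ≤ a) (d y : ℝ) :
    kill d (fun u => h (u + a)) y ≤ kill 0 h (y + (d + a)) := by
  have h1 : Measurable fun u => h (u + a) := by fun_prop
  rw [kill_eq_indicator, kill_eq_indicator,
    lintegral_gaussianReal_shift (h1.indicator measurableSet_Ioi),
    lintegral_gaussianReal_shift (hm.indicator measurableSet_Ioi)]
  refine lintegral_mono fun ξ => ?_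
  by_cases h0 : 0 < y + d + ξ
  · rw [indicator_of_mem (mem_Ioi.2 h0), indicator_of_mem (mem_Ioi.2 (by linarith))]
    exact le_of_eq (congrArg h (by ring))
  · simp [indicator_of_notMem (show y + d + ξ ∉ Ioi (0 : ℝ) from h0)]

/-- All upward drift may be granted at the start, which only helps survival. This is useful as long
as the total drift is bounded. -/
lemma killIter_one_le_shift {d : ℕ → ℝ} {k : ℕ} (hd : ∀ i < k, 0 ≤ d i) {y : ℝ} (hy : 0 < y) :
    killIter d k 1 y ≤ killIter (fun _ => 0) k 1 (y + ∑ i ∈ Finset.range k, d i) := by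
  induction k generalizing d y with
  | zero => simp [killIter]
  | succ k ih =>
    have hm : Measurable (killIter (fun _ => 0) k 1) := measurable_killIter measurable_one _ _
    rw [killIter_succ', killIter_succ', Finset.sum_range_succ', add_comm _ (d 0)]
    refine (kill_mono (fun u hu => ih (fun i hi => hd (i + 1) (by omega)) hu) _ _).trans ?_
    exact kill_comp_add_le hm (Finset.sum_nonneg fun i hi =>
      hd _ (by have := Finset.mem_range.1 hi; omega)) _ _

lemma mul_sqrt_eq_rpow {x : ℝ} (hx : 0 < x) : x * √x = x ^ (3 / 2 : ℝ) := by
  rw [Real.sqrt_eq_rpow, ← Real.rpow_one_add' hx.le (by norm_num)]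
  norm_num

lemma summable_inv_mul_sqrt : Summable fun i : ℕ => (((i : ℝ) + 1) * √((i : ℝ) + 1))⁻¹ := by
  have h := (summable_nat_add_iff 1).2
    (Real.summable_nat_rpow_inv.2 (by norm_num : (1 : ℝ) < 3 / 2))
  refine h.congr fun i => ?_
  rw [mul_sqrt_eq_rpow (by positivity)]
  push_cast
  rfl

/-- Half of the time of survival costs the diffusive factor. -/
lemma exists_survival_le_half {c : ℝ} (hc : 0 ≤ c) : ∃ B : ℝ, 0 < B ∧ ∀ (r : ℕ) (y : ℝ), 0 < y →
    killIter (fun i => c / (i + 1)) r 1 y ≤ ENNReal.ofReal (B / √(r + 1)) *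
      killIter (fun i => c / (i + 1)) (r / 2) (fun u => ENNReal.ofReal (u + 2)) y := by
  obtain ⟨A, hA, hsurv⟩ := exists_survival_le
  refine ⟨2 * A * (1 + c), by positivity, fun r y hy => ?_⟩
  set p := r / 2 with hp
  obtain ⟨q, hq⟩ : ∃ q, r = p + q := ⟨r - p, by omega⟩
  rw [← killIter_const_mul (by fun_prop)]
  conv_lhs => rw [hq, killIter_add]
  refine killIter_mono (fun u hu => ?_) _ _ hy
  refine (killIter_one_le_shift (fun i _ => by positivity) hu).trans ?_
  -- The second half consists of at most `p + 1` steps, each of drift at most `c / (p + 1)`, so its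
  -- total drift is at most `c`.
  have hsum : ∑ i ∈ Finset.range q, c / (((p + i : ℕ) : ℝ) + 1) ≤ c := by
    have h1 : ∀ i ∈ Finset.range q, c / (((p + i : ℕ) : ℝ) + 1) ≤ c / ((p : ℝ) + 1) := by
      intro i _
      push_cast
      gcongr
      linarith [Nat.cast_nonneg (α := ℝ) i]
    refine (Finset.sum_le_sum h1).trans ?_
    rw [Finset.sum_const, Finset.card_range, nsmul_eq_mul, mul_div_assoc', div_le_iff₀ (by positivity)]
    have : (q : ℝ) ≤ p + 1 := by exact_mod_cast (by omega : q ≤ p + 1)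
    nlinarith
  have hsum0 : 0 ≤ ∑ i ∈ Finset.range q, c / (((p + i : ℕ) : ℝ) + 1) :=
    Finset.sum_nonneg fun i _ => by positivity
  refine (hsurv q _ (by linarith)).trans ?_
  rw [← ENNReal.ofReal_mul (by positivity)]
  refine ENNReal.ofReal_le_ofReal ?_
  have hr : (r : ℝ) + 1 ≤ 2 ^ 2 * ((q : ℝ) + 1) := by
    have : (r : ℝ) + 1 ≤ 4 * (q + 1) := by exact_mod_cast (by omega : r + 1 ≤ 4 * (q + 1))
    linarith
  have hsq : √((r : ℝ) + 1) ≤ 2 * √((q : ℝ) + 1) := by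
    refine (Real.sqrt_le_sqrt hr).trans (le_of_eq ?_)
    rw [Real.sqrt_mul (by positivity), Real.sqrt_sq (by norm_num)]
  rw [div_mul_eq_mul_div, div_le_div_iff₀ (by positivity) (by positivity)]
  have h2 : A * (u + ∑ i ∈ Finset.range q, c / (((p + i : ℕ) : ℝ) + 1) + 2) ≤
      A * ((1 + c) * (u + 2)) := mul_le_mul_of_nonneg_left (by nlinarith) hA.le
  calc _ ≤ A * ((1 + c) * (u + 2)) * (2 * √((q : ℝ) + 1)) :=
        mul_le_mul h2 hsq (by positivity) (by positivity)
    _ = _ := by ring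

/-- Survival of the walk whose drift after `r` steps is `c / (r + 1)`. -/
theorem exists_survival_harmonic_le {c : ℝ} (hc : 0 ≤ c) : ∃ K : ℝ, 0 < K ∧ ∀ (r : ℕ) (y : ℝ),
    0 < y → killIter (fun i => c / (i + 1)) r 1 y ≤ ENNReal.ofReal (K * (y + 2) / √(r + 1)) := by
  obtain ⟨B, hB, hhalf⟩ := exists_survival_le_half hc
  set D : ℕ → ℝ := fun i => c / (i + 1) with hD
  -- `w r` is the drift `c / (r + 1)` times the survival factor `B / √(r + 1)`: the relative growth
  -- of the expectation of `u + 2` in one step, and summable.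
  set w : ℕ → ℝ := fun i => c * B * (((i : ℝ) + 1) * √((i : ℝ) + 1))⁻¹ with hw
  have hw0 : ∀ i, 0 ≤ w i := fun i => by positivity
  have hws : Summable w := summable_inv_mul_sqrt.mul_left _
  set E : ℕ → ℝ := fun r => Real.exp (∑ i ∈ Finset.range r, w i) with hE
  have hEm : Monotone E := fun a b hab => Real.exp_le_exp.2
    (Finset.sum_le_sum_of_subset_of_nonneg (Finset.range_mono hab) fun i _ _ => hw0 i)
  -- Bootstrap: drift raises the expectation of `u + 2` only on survival, and survival for `r` steps
  -- is controlled by the same expectation after `r / 2` steps. Hence the strong induction.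
  have key : ∀ (r : ℕ) (y : ℝ), 0 < y →
      killIter D r (fun u => ENNReal.ofReal (u + 2)) y ≤ ENNReal.ofReal (E r * (y + 2)) := by
    intro r
    induction r using Nat.strong_induction_on with
    | _ r ih =>
    intro y hy
    cases r with
    | zero => simp [killIter, E]
    | succ r =>
      have hDr : 0 ≤ D r := by positivity
      have h1 : killIter D (r + 1) (fun u => ENNReal.ofReal (u + 2)) y ≤
          killIter D r (fun u => ENNReal.ofReal (u + 2)) y +
            ENNReal.ofReal (D r) * killIter D r 1 y := by
        rw [← killIter_const_mul measurable_one, ← killIter_add_fun (by fun_prop)]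
        refine killIter_mono (fun u hu => ?_) _ _ hy
        refine (kill_id_add_two_le (by linarith)).trans (le_of_eq ?_)
        rw [Pi.one_apply, mul_one, ← ENNReal.ofReal_add (by linarith) hDr]
        congr 1
        ring
      refine h1.trans ?_
      have h2 := ih r (Nat.lt_succ_self r) y hy
      have h3 := (hhalf r y hy).trans
        (mul_le_mul_right (ih (r / 2) (by omega) y hy) _)
      refine (add_le_add h2 (mul_le_mul_right h3 _)).trans ?_
      rw [← ENNReal.ofReal_mul (by positivity), ← ENNReal.ofReal_mul hDr,
        ← ENNReal.ofReal_add (by positivity) (by positivity)]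
      refine ENNReal.ofReal_le_ofReal ?_
      have h4 : E (r / 2) ≤ E r := hEm (Nat.div_le_self r 2)
      have h5 : E (r + 1) = E r * Real.exp (w r) := by
        simp only [E]
        rw [Finset.sum_range_succ, Real.exp_add]
      have h6 : D r * (B / √((r : ℝ) + 1)) = w r := by
        simp only [D, w]
        rw [mul_inv]
        ring
      have hE0 : 0 < E r := Real.exp_pos _
      calc E r * (y + 2) + D r * (B / √((r : ℝ) + 1) * (E (r / 2) * (y + 2)))
          = E r * (y + 2) + w r * E (r / 2) * (y + 2) := by rw [← h6]; ring
        _ ≤ E r * (y + 2) + w r * E r * (y + 2) := by gcongr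
        _ = E r * (w r + 1) * (y + 2) := by ring
        _ ≤ E r * Real.exp (w r) * (y + 2) := by gcongr; exact Real.add_one_le_exp _
        _ = _ := by rw [h5]
  refine ⟨B * Real.exp (∑' i, w i), by positivity, fun r y hy => ?_⟩
  refine (hhalf r y hy).trans ((mul_le_mul_right (key (r / 2) y hy) _).trans ?_)
  rw [← ENNReal.ofReal_mul (by positivity)]
  refine ENNReal.ofReal_le_ofReal ?_
  have hEb : E (r / 2) ≤ Real.exp (∑' i, w i) :=
    Real.exp_le_exp.2 (hws.sum_le_tsum _ fun i _ => hw0 i)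
  calc B / √((r : ℝ) + 1) * (E (r / 2) * (y + 2))
      ≤ B / √((r : ℝ) + 1) * (Real.exp (∑' i, w i) * (y + 2)) := by gcongr
    _ = _ := by ring

/-! ### Duality and the local estimate -/

lemma kill_eq_lintegral_pdf {f : ℝ → ℝ≥0∞} (hf : Measurable f) (d y : ℝ) :
    kill d f y = ∫⁻ u in Ioi 0, gaussianPDF (y + d) 1 u * f u := by
  rw [kill_eq_indicator, gaussianReal_of_var_ne_zero _ one_ne_zero,
    lintegral_withDensity_eq_lintegral_mul _ (measurable_gaussianPDF _ _)
    (hf.indicator measurableSet_Ioi), ← lintegral_indicator measurableSet_Ioi]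
  refine lintegral_congr fun u => ?_
  by_cases h : u ∈ Ioi (0 : ℝ) <;> simp [h]

lemma gaussianPDF_comm (d y u : ℝ) (v : ℝ≥0) :
    gaussianPDF (y + d) v u = gaussianPDF (u + -d) v y := by
  simp only [gaussianPDF, gaussianPDFReal]
  congr 4
  ring

/-- The Gaussian transition density from `y` to `u` with drift `d` equals the one from `u` to `y`
with drift `-d`. The adjoint on the half-line for Lebesgue measure is therefore again a killed walk.
-/
lemma lintegral_mul_kill {f h : ℝ → ℝ≥0∞} (hf : Measurable f) (hh : Measurable h) (d : ℝ) :
    ∫⁻ y in Ioi 0, h y * kill d f y = ∫⁻ u in Ioi 0, kill (-d) h u * f u := by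
  have hpdf : Measurable fun p : ℝ × ℝ => gaussianPDF (p.1 + d) 1 p.2 :=
    measurable_uncurry_gaussianPDF.comp
      (((measurable_fst.add_const d).prodMk (measurable_const.prodMk measurable_snd)))
  have hy : ∀ y, Measurable fun u => gaussianPDF (y + d) 1 u * f u := fun y =>
    (measurable_gaussianPDF _ _).mul hf
  have hu : ∀ u, Measurable fun y => gaussianPDF (u + -d) 1 y * h y := fun u =>
    (measurable_gaussianPDF _ _).mul hh
  simp only [kill_eq_lintegral_pdf hf, kill_eq_lintegral_pdf hh]
  simp only [← lintegral_const_mul _ (hy _), ← lintegral_mul_const _ (hu _)]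
  rw [lintegral_lintegral_swap]
  · refine lintegral_congr fun u => lintegral_congr fun y => ?_
    rw [gaussianPDF_comm]
    ring
  · refine Measurable.aemeasurable ?_
    exact (hh.comp measurable_fst).mul (hpdf.mul (hf.comp measurable_snd))

/-- Time reversal: adjoints compose in the opposite order, so the reversed walk meets the drifts
last to first with opposite signs. -/
lemma lintegral_mul_killIter {f h : ℝ → ℝ≥0∞} (hf : Measurable f) (hh : Measurable h) (d : ℕ → ℝ)
    (k : ℕ) : ∫⁻ y in Ioi 0, h y * killIter d k f y =
      ∫⁻ u in Ioi 0, killIter (fun r => -d (k - 1 - r)) k h u * f u := by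
  induction k generalizing f with
  | zero => rfl
  | succ k ih =>
    simp only [killIter_succ' (fun r => -d (k + 1 - 1 - r))]
    refine (ih (measurable_kill hf (d k))).trans ?_
    rw [lintegral_mul_kill hf (measurable_killIter hh _ _)]
    simp only [Nat.add_sub_cancel, Nat.sub_zero, Nat.sub_sub, add_comm]

/-- Forget all killing except at the final time; the remaining free walk is Gaussian with the summed
drift and variance `k`. -/
lemma killIter_le_lintegral_gaussianReal {f : ℝ → ℝ≥0∞} (hf : Measurable f) (d : ℕ → ℝ) (k : ℕ)
    {y : ℝ} (hy : 0 < y) : killIter d k f y ≤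
      ∫⁻ u, (Ioi 0).indicator f u ∂gaussianReal (y + ∑ i ∈ Finset.range k, d i) k := by
  have hi := hf.indicator (measurableSet_Ioi (a := (0 : ℝ)))
  induction k generalizing d y with
  | zero => simp [killIter, gaussianReal_zero_var, lintegral_dirac' _ hi, hy]
  | succ k ih =>
    rw [killIter_succ', Finset.sum_range_succ']
    set a := ∑ i ∈ Finset.range k, d (i + 1)
    refine (kill_mono (fun u hu => ih (fun i => d (i + 1)) hu) _ _).trans
      ((setLIntegral_le_lintegral _ _).trans (le_of_eq ?_))
    have hH := measurable_lintegral_gaussianReal hi k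
    have h1 := lintegral_gaussianReal_affine hH a 1 (y + d 0) (v := 1) (w := 1) (by simp)
    simp only [one_mul, add_comm a] at h1
    rw [h1, lintegral_lintegral_gaussianReal hi]
    push_cast
    congr 2
    · ring
    · ring

lemma lintegral_exp_neg_mul_lt_top {η : ℝ} (hη : 0 < η) :
    ∫⁻ u in Ioi 0, ENNReal.ofReal ((u + 2) * Real.exp (-(η * u))) < ⊤ := by
  have h1 : IntegrableOn (fun u : ℝ => u * Real.exp (-(η * u))) (Ioi 0) := by
    have := integrableOn_rpow_mul_exp_neg_mul_rpow (p := 1) (s := 1) (by norm_num) one_pos hη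
    simpa using this
  have h2 : IntegrableOn (fun u : ℝ => 2 * Real.exp (-(η * u))) (Ioi 0) := by
    have := (exp_neg_integrableOn_Ioi 0 hη).const_mul 2
    simpa [IntegrableOn] using this
  have h3 : IntegrableOn (fun u : ℝ => (u + 2) * Real.exp (-(η * u))) (Ioi 0) := by
    refine (h1.add h2).congr_fun (fun u _ => ?_) measurableSet_Ioi
    simp only [Pi.add_apply]
    ring
  exact h3.lintegral_lt_top

/-- Expected exponential weight of a walk that has a downward drift and stays positive: three
stretches contribute the survival probability, the diffusive density, and the survival probability
of the reversed walk. -/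
theorem exists_killIter_exp_le {c η : ℝ} (hc : 0 ≤ c) (hη : 0 < η) : ∃ C : ℝ, 0 < C ∧
    ∀ (k : ℕ) (d : ℕ → ℝ), (∀ i < k, d i ≤ 0) → (∀ r < k, -d (k - 1 - r) ≤ c / (r + 1)) →
      ∀ y : ℝ, 0 < y → killIter d k (fun u => ENNReal.ofReal (Real.exp (-(η * u)))) y ≤
        ENNReal.ofReal (C * (y + 2) / ((k + 1) * √(k + 1))) := by
  obtain ⟨A, hA, hsurv⟩ := exists_survival_le
  obtain ⟨K, hK, hharm⟩ := exists_survival_harmonic_le hc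
  set f : ℝ → ℝ≥0∞ := fun u => ENNReal.ofReal (Real.exp (-(η * u))) with hf
  have hfm : Measurable f := by fun_prop
  set I := (∫⁻ u in Ioi 0, ENNReal.ofReal ((u + 2) * Real.exp (-(η * u)))).toReal with hI
  have hI' : ∫⁻ u in Ioi 0, ENNReal.ofReal ((u + 2) * Real.exp (-(η * u))) = ENNReal.ofReal I :=
    (ENNReal.ofReal_toReal (lintegral_exp_neg_mul_lt_top hη).ne).symm
  have hI0 : 0 ≤ I := ENNReal.toReal_nonneg
  -- The summand `1` covers `k = 0`. The factor `18 = 3 · 6` comes from `k + 1 ≤ 3 (p + 1)` and `√(k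
  -- + 1) ≤ 6 √q`, for outer stretches of `p` steps and a middle one of `q` steps.
  refine ⟨1 + 18 * A * K * I, by positivity, fun k d hd hdr y hy => ?_⟩
  rcases Nat.eq_zero_or_pos k with rfl | hk
  · refine ENNReal.ofReal_le_ofReal ?_
    have h1 : Real.exp (-(η * y)) ≤ 1 := Real.exp_le_one_iff.2 (by nlinarith)
    have h2 : 0 ≤ A * K * I := by positivity
    simp only [Nat.cast_zero, zero_add, Real.sqrt_one, mul_one, div_one]
    nlinarith
  set p := k / 3 with hp
  obtain ⟨q, hq⟩ : ∃ q, k = p + q + p := ⟨k - p - p, by omega⟩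
  have hq0 : 0 < q := by omega
  set d₂ : ℕ → ℝ := fun i => d (p + i)
  set d₃ : ℕ → ℝ := fun i => d (p + q + i)
  -- Integrated over its starting point, the last stretch is by duality the survival of the reversed
  -- walk, weighted by the exponential. The reversed drift is upward and at most harmonic.
  have hlast : ∫⁻ u in Ioi 0, killIter d₃ p f u ≤ ENNReal.ofReal (K / √(p + 1)) *
      ENNReal.ofReal I := by
    have h1 := lintegral_mul_killIter hfm measurable_one d₃ p
    simp only [Pi.one_apply, one_mul] at h1
    rw [h1, ← hI', ← lintegral_const_mul _ (by fun_prop)]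
    refine setLIntegral_mono' measurableSet_Ioi fun u hu => ?_
    have h2 : killIter (fun r => -d₃ (p - 1 - r)) p 1 u ≤ killIter (fun i => c / (i + 1)) p 1 u := by
      refine killIter_le_killIter monotone_const measurable_one (fun r hr => ?_) hu
      have h3 := hdr r (by omega)
      rw [show k - 1 - r = p + q + (p - 1 - r) by omega] at h3
      exact h3
    refine (mul_le_mul_left (h2.trans (hharm p u hu)) _).trans (le_of_eq ?_)
    have hu' : (0 : ℝ) < u := hu
    rw [← ENNReal.ofReal_mul (by positivity), ← ENNReal.ofReal_mul (by positivity)]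
    congr 1
    ring
  -- The free density after `q` steps is at most `1 / √q`, uniformly in the starting point, which
  -- reduces the rest to the Lebesgue integral in `hlast`.
  have hmid : ∀ u, 0 < u → killIter d₂ q (killIter d₃ p f) u ≤
      ENNReal.ofReal (√q)⁻¹ * (ENNReal.ofReal (K / √(p + 1)) * ENNReal.ofReal I) := by
    intro u hu
    have hm : Measurable (killIter d₃ p f) := measurable_killIter hfm _ _
    have hq' : (q : ℝ≥0) ≠ 0 := by positivity
    refine (killIter_le_lintegral_gaussianReal hm d₂ q hu).trans
      ((lintegral_gaussianReal_le (hm.indicator measurableSet_Ioi) _ hq').trans ?_)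
    rw [lintegral_indicator measurableSet_Ioi]
    have hq1 : (0 : ℝ) < q := by exact_mod_cast hq0
    have hsq : (√(2 * Real.pi * ((q : ℝ≥0) : ℝ)))⁻¹ ≤ (√(q : ℝ))⁻¹ := by
      push_cast
      gcongr
      nlinarith [Real.pi_gt_three]
    exact mul_le_mul' (ENNReal.ofReal_le_ofReal hsq) hlast
  have hsplit : killIter d k f y = killIter d p (killIter d₂ q (killIter d₃ p f)) y := by
    conv_lhs => rw [hq, killIter_add, killIter_add]
  rw [hsplit]
  refine (killIter_mono hmid _ _ hy).trans ?_
  set Q := ENNReal.ofReal (√q)⁻¹ * (ENNReal.ofReal (K / √(p + 1)) * ENNReal.ofReal I) with hQ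
  have h1 := killIter_const_mul measurable_one Q d p y
  simp only [Pi.one_apply, mul_one] at h1
  rw [h1]
  have h2 : killIter d p 1 y ≤ ENNReal.ofReal (A * (y + 2) / √(p + 1)) :=
    (killIter_le_killIter monotone_const measurable_one (fun i hi => hd i (by omega)) hy).trans
      (hsurv p y hy)
  refine (mul_le_mul_right h2 Q).trans ?_
  rw [hQ, ← ENNReal.ofReal_mul (by positivity), ← ENNReal.ofReal_mul (by positivity),
    ← ENNReal.ofReal_mul (by positivity)]
  refine ENNReal.ofReal_le_ofReal ?_
  have hp3 : (k : ℝ) + 1 ≤ 3 * (p + 1) := by exact_mod_cast (by omega : k + 1 ≤ 3 * (p + 1))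
  have hq6 : (k : ℝ) + 1 ≤ 6 ^ 2 * q := by
    have : (k : ℝ) + 1 ≤ 36 * q := by exact_mod_cast (by omega : k + 1 ≤ 36 * q)
    linarith
  have hsq6 : √((k : ℝ) + 1) ≤ 6 * √q := by
    refine (Real.sqrt_le_sqrt hq6).trans (le_of_eq ?_)
    rw [Real.sqrt_mul (by positivity), Real.sqrt_sq (by norm_num)]
  have hq1 : (0 : ℝ) < q := by exact_mod_cast hq0
  have hpp : √((p : ℝ) + 1) * √((p : ℝ) + 1) = p + 1 := Real.mul_self_sqrt (by positivity)
  calc (√(q : ℝ))⁻¹ * (K / √((p : ℝ) + 1) * I) * (A * (y + 2) / √((p : ℝ) + 1))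
      = A * K * I * (y + 2) / (√((p : ℝ) + 1) * √((p : ℝ) + 1) * √q) := by
        field_simp
    _ = 18 * A * K * I * (y + 2) / (3 * (p + 1) * (6 * √q)) := by
        rw [hpp]
        field_simp
        ring
    _ ≤ 18 * A * K * I * (y + 2) / ((k + 1) * √((k : ℝ) + 1)) := by gcongr
    _ ≤ _ := by gcongr; linarith

/-! ### A homogeneous stretch -/

lemma g_pos : 0 < g := Real.sqrt_pos.2 (mul_pos two_pos (Real.log_pos one_lt_two))

lemma g_sq : g ^ 2 = 2 * Real.log 2 :=
  Real.sq_sqrt (mul_nonneg zero_le_two (Real.log_nonneg one_le_two))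

lemma exp_g_sq_div_two : Real.exp (g ^ 2 / 2) = 2 := by
  rw [g_sq, mul_div_cancel_left₀ _ two_ne_zero, Real.exp_log two_pos]

/-- `(m + 1) ^ (-3/2)`. -/
noncomputable def decay (m : ℕ) : ℝ := (((m : ℝ) + 1) * √((m : ℝ) + 1))⁻¹

lemma decay_pos (m : ℕ) : 0 < decay m := by unfold decay; positivity

lemma decay_eq_exp (m : ℕ) : decay m = Real.exp (-(3 / 2 * Real.log (m + 1))) := by
  rw [decay, mul_sqrt_eq_rpow (by positivity), Real.rpow_def_of_pos (by positivity), Real.exp_neg,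
    mul_comm]

lemma decay_le {m n : ℕ} (h : n + 1 ≤ 2 * (m + 1)) : decay m ≤ 3 * decay n := by
  unfold decay
  have h1 : (n : ℝ) + 1 ≤ 2 * (m + 1) := by exact_mod_cast h
  have h2 : √((n : ℝ) + 1) ≤ 3 / 2 * √((m : ℝ) + 1) := by
    rw [Real.sqrt_le_left (by positivity), mul_pow, Real.sq_sqrt (by positivity)]
    linarith
  rw [← div_eq_mul_inv, le_div_iff₀ (by positivity), inv_mul_le_iff₀ (by positivity)]
  calc ((n : ℝ) + 1) * √((n : ℝ) + 1) ≤ (2 * (m + 1)) * (3 / 2 * √((m : ℝ) + 1)) := by gcongr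
    _ = _ := by ring

/-- One of `k` and `N - k` is at least half of `N`, so one factor is at most `3 * decay N`, while
the other is summable. -/
lemma exists_sum_decay_mul_decay_le : ∃ C : ℝ, 0 < C ∧ ∀ N : ℕ,
    ∑ k ∈ Finset.range (N + 1), decay (N - k) * decay k ≤ C * decay N := by
  have hs : Summable decay := summable_inv_mul_sqrt
  have hsum : ∀ N : ℕ, ∑ k ∈ Finset.range N, decay k ≤ ∑' k, decay k := fun N =>
    hs.sum_le_tsum _ fun k _ => (decay_pos k).le
  refine ⟨6 * ∑' k, decay k, mul_pos (by norm_num) (hs.tsum_pos (fun k => (decay_pos k).le) 0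
    (decay_pos 0)), fun N => ?_⟩
  have h1 : ∀ k ∈ Finset.range (N + 1), decay (N - k) * decay k ≤
      3 * decay N * (decay k + decay (N - k)) := by
    intro k hk
    have hk' := Finset.mem_range.1 hk
    have p1 := decay_pos k
    have p2 := decay_pos (N - k)
    have p3 := decay_pos N
    rcases le_total k (N - k) with h | h
    · have := mul_le_mul_of_nonneg_right (decay_le (show N + 1 ≤ 2 * (N - k + 1) by omega)) p1.le
      nlinarith [mul_pos p3 p2]
    · have := mul_le_mul_of_nonneg_left (decay_le (show N + 1 ≤ 2 * (k + 1) by omega)) p2.le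
      nlinarith [mul_pos p3 p1]
  refine (Finset.sum_le_sum h1).trans ?_
  rw [← Finset.mul_sum, Finset.sum_add_distrib]
  have h2 := Finset.sum_range_reflect decay (N + 1)
  simp only [Nat.add_sub_cancel] at h2
  have h3 : ∑ k ∈ Finset.range (N + 1), decay (N - k) = ∑ k ∈ Finset.range (N + 1), decay k := h2
  rw [h3]
  have := mul_le_mul_of_nonneg_left (hsum (N + 1)) (show 0 ≤ 6 * decay N by
    have := decay_pos N; positivity)
  linarith

/-- The drift of the logarithmic barrier when `m` generations remain after the step. -/
noncomputable def barrierDrift (m : ℕ) : ℝ :=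
  3 / (2 * g) * (Real.log ((m : ℝ) + 2) - Real.log ((m : ℝ) + 1))

lemma barrierDrift_nonneg (m : ℕ) : 0 ≤ barrierDrift m := by
  have := g_pos
  refine mul_nonneg (by positivity) (sub_nonneg.2 (Real.log_le_log (by positivity) (by linarith)))

lemma barrierDrift_le (m : ℕ) : barrierDrift m ≤ 3 / (2 * g) / (m + 1) := by
  have := g_pos
  rw [barrierDrift, div_eq_mul_inv _ ((m : ℝ) + 1), ← Real.log_div (by positivity) (by positivity)]
  refine mul_le_mul_of_nonneg_left ((Real.log_le_sub_one_of_pos (by positivity)).trans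
    (le_of_eq ?_)) (by positivity)
  field_simp
  ring

/-- The barrier is chosen for this identity: its motion costs `exp(-g * barrierDrift m)` under the
tilt, exactly the ratio of consecutive weights `decay`. -/
lemma decay_succ (m : ℕ) : decay (m + 1) = decay m * Real.exp (-(g * barrierDrift m)) := by
  have := g_pos.ne'
  rw [decay_eq_exp, decay_eq_exp, ← Real.exp_add, barrierDrift]
  congr 1
  push_cast
  rw [show (m : ℝ) + 1 + 1 = m + 2 by ring]
  field_simp
  ring

/-- The value function of a homogeneous stretch, seen from the logarithmic barrier at distance
`σ y`, after the exponential change of measure. -/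
noncomputable def tiltedValue (σ β : ℝ) (f : ℝ → ℝ≥0∞) (m : ℕ) (y : ℝ) : ℝ≥0∞ :=
  ENNReal.ofReal (decay m) * (ENNReal.ofReal (Real.exp (g * y)) *
    f (β - (g * σ * m - 3 * σ / (2 * g) * Real.log (m + 1)) - σ * y))

/-- Tilting by `g` produces `exp(g²/2) = 2`, which accounts for the branching factor, and shifts the
mean by `g`, which cancels the linear part of the barrier. Only the logarithmic part remains as
drift, and `decay_succ` absorbs its weight. -/
lemma tiltedValue_branchStep (σ β : ℝ) {f : ℝ → ℝ≥0∞} (hf : Measurable f)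
    {v : ℝ≥0} (hv : (v : ℝ) = σ ^ 2) (m : ℕ) (y : ℝ) :
    tiltedValue σ β (branchStep v f) (m + 1) y =
      ∫⁻ u, tiltedValue σ β (fun s => min 1 (f s)) m u ∂gaussianReal (y - barrierDrift m) 1 := by
  have hg := g_pos
  set b := β - (g * σ * m - 3 * σ / (2 * g) * Real.log (m + 1)) with hb
  have hm : Measurable fun s => min 1 (f s) := measurable_const.min hf
  have haff := lintegral_gaussianReal_affine hm b (-σ) (y - barrierDrift m + g) (v := 1) (w := v)
    (by simp [hv])
  have hmean : b + -σ * (y - barrierDrift m + g) =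
      β - (g * σ * (m + 1 : ℕ) - 3 * σ / (2 * g) * Real.log ((m + 1 : ℕ) + 1)) - σ * y := by
    rw [hb, barrierDrift]
    push_cast
    rw [show (m : ℝ) + 1 + 1 = m + 2 by ring]
    field_simp
    ring
  rw [hmean] at haff
  have htilt := lintegral_exp_mul_gaussianReal (f := fun u => min 1 (f (b + -σ * u)))
    (by fun_prop) g (y - barrierDrift m) 1
  simp only [NNReal.coe_one, mul_one] at htilt
  have hexp : Real.exp (g * (y - barrierDrift m) + g ^ 2 / 2) =
      2 * (Real.exp (g * y) * Real.exp (-(g * barrierDrift m))) := by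
    rw [Real.exp_add, exp_g_sq_div_two, ← Real.exp_add, mul_comm]
    congr 2
    ring
  unfold tiltedValue branchStep
  rw [lintegral_const_mul _ (by fun_prop), ← haff]
  have hsub : ∀ u, β - (g * σ * m - 3 * σ / (2 * g) * Real.log (m + 1)) - σ * u = b + -σ * u :=
    fun u => by rw [hb]; ring
  simp only [hsub]
  rw [htilt, hexp, decay_succ]
  have p1 := (decay_pos m).le
  rw [ENNReal.ofReal_mul p1, ENNReal.ofReal_mul zero_le_two, ENNReal.ofReal_mul (Real.exp_nonneg _)]
  simp only [ENNReal.ofReal_ofNat]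
  ring

lemma lintegral_exp_neg_gaussianReal_le {η a b : ℝ} (hη : 0 ≤ η) (y : ℝ) (ha : a ≤ b) :
    ∫⁻ u, ENNReal.ofReal (Real.exp (-(η * u))) ∂gaussianReal (y - a) 1 ≤
      ENNReal.ofReal (Real.exp (η * b + η ^ 2 / 2)) * ENNReal.ofReal (Real.exp (-(η * y))) := by
  have h := lintegral_exp_mul_gaussianReal (f := 1) measurable_one (-η) (y - a) 1
  simp only [Pi.one_apply, mul_one, lintegral_one, measure_univ, neg_mul] at h
  rw [h, ← ENNReal.ofReal_mul (Real.exp_nonneg _), ← Real.exp_add]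
  refine ENNReal.ofReal_le_ofReal (Real.exp_le_exp.2 ?_)
  have := mul_le_mul_of_nonneg_left ha hη
  simp only [neg_sq, NNReal.coe_one, mul_one]
  linarith

lemma kill_finset_sum {ι : Type*} (s : Finset ι) {f : ι → ℝ → ℝ≥0∞} (hf : ∀ i, Measurable (f i))
    (d y : ℝ) : kill d (fun u => ∑ i ∈ s, f i u) y = ∑ i ∈ s, kill d (f i) y :=
  lintegral_finsetSum s fun i _ => hf i

/-- Split by whether the particle lands beyond the barrier. For `u ≤ 0` the truncation gives `1`,
and `exp(g u) ≤ 1 ≤ exp(-η u)` leaves a source term. For `u > 0` the truncation is dropped and one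
killed step remains. -/
lemma tiltedValue_branchStep_le (σ β : ℝ) {f : ℝ → ℝ≥0∞} (hf : Measurable f)
    {v : ℝ≥0} (hv : (v : ℝ) = σ ^ 2) {η : ℝ} (hη : 0 < η) (m : ℕ) (y : ℝ) :
    tiltedValue σ β (branchStep v f) (m + 1) y ≤
      ENNReal.ofReal (Real.exp (η * (3 / (2 * g)) + η ^ 2 / 2) * decay m) *
        ENNReal.ofReal (Real.exp (-(η * y))) + kill (-barrierDrift m) (tiltedValue σ β f m) y := by
  have hg := g_pos
  rw [tiltedValue_branchStep σ β hf hv]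
  have hdm : barrierDrift m ≤ 3 / (2 * g) := (barrierDrift_le m).trans
    (div_le_self (by positivity) (by linarith [Nat.cast_nonneg (α := ℝ) m]))
  rw [← lintegral_add_compl _ (measurableSet_Ioi (a := (0 : ℝ))), add_comm]
  refine add_le_add ?_ ?_
  · rw [compl_Ioi, mul_comm (Real.exp _), ENNReal.ofReal_mul (decay_pos m).le, mul_assoc]
    refine le_trans ?_ (mul_le_mul_right (lintegral_exp_neg_gaussianReal_le hη.le y hdm) _)
    rw [← lintegral_const_mul _ (by fun_prop)]
    refine (setLIntegral_mono' measurableSet_Iic fun u hu => ?_).trans (setLIntegral_le_lintegral _ _)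
    have hu0 : u ≤ 0 := hu
    refine mul_le_mul_right ((mul_le_mul_right (min_le_left _ _) _).trans ?_) _
    rw [mul_one]
    exact ENNReal.ofReal_le_ofReal (Real.exp_le_exp.2 (by nlinarith))
  · rw [sub_eq_add_neg]
    exact setLIntegral_mono' measurableSet_Ioi fun u _ =>
      mul_le_mul_right (mul_le_mul_right (min_le_right _ _) _) _

/-- Iterating the one-step bound decomposes over the number `k` of steps spent below the barrier
before crossing it, with `k = N` the case of reaching the end. Crossing and ending both leave the
payoff `exp(-η u)`. -/
lemma tiltedValue_le_sum (σ β : ℝ) {f : ℝ → ℝ≥0∞} (hf : Measurable f)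
    {v : ℝ≥0} (hv : (v : ℝ) = σ ^ 2) {η C : ℝ} (hη : 0 < η) (hC : 0 ≤ C)
    (h0 : ∀ y, f (β - σ * y) ≤ ENNReal.ofReal (C * Real.exp (-((g + η) * y)))) (N : ℕ) {y : ℝ}
    (hy : 0 < y) :
    tiltedValue σ β ((List.replicate N v).foldr branchStep f) N y ≤
      ∑ k ∈ Finset.range (N + 1), ENNReal.ofReal
        ((C + 3 * Real.exp (η * (3 / (2 * g)) + η ^ 2 / 2)) * decay (N - k)) *
          killIter (fun i => -barrierDrift (N - 1 - i)) k
            (fun u => ENNReal.ofReal (Real.exp (-(η * u)))) y := by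
  set K := Real.exp (η * (3 / (2 * g)) + η ^ 2 / 2) with hK
  have hK0 : 0 < K := Real.exp_pos _
  induction N generalizing y with
  | zero =>
    simp only [tiltedValue, killIter, List.replicate_zero, List.foldr_nil, zero_add,
      Finset.range_one, Finset.sum_singleton, Nat.cast_zero, mul_zero, Real.log_one, sub_zero]
    rw [mul_comm _ (decay 0), ENNReal.ofReal_mul (decay_pos 0).le, mul_assoc]
    refine mul_le_mul_right ((mul_le_mul_right (h0 y) _).trans ?_) _
    rw [← ENNReal.ofReal_mul (Real.exp_nonneg _), ← ENNReal.ofReal_mul (by positivity),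
      mul_left_comm, ← Real.exp_add]
    refine ENNReal.ofReal_le_ofReal ?_
    rw [show g * y + -((g + η) * y) = -(η * y) by ring]
    gcongr
    linarith
  | succ N ih =>
    rw [List.replicate_succ, List.foldr_cons]
    refine (tiltedValue_branchStep_le σ β (measurable_foldr_branchStep hf _) hv hη N y).trans ?_
    rw [Finset.sum_range_succ', add_comm]
    refine add_le_add ?_ ?_
    · have hm : ∀ k, Measurable (killIter (fun i => -barrierDrift (N - 1 - i)) k
            (fun u => ENNReal.ofReal (Real.exp (-(η * u))))) := fun k =>
        measurable_killIter (by fun_prop) _ _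
      refine (kill_mono (fun u hu => ih hu) _ _).trans (le_of_eq ?_)
      rw [kill_finset_sum _ fun k => (hm k).const_mul _]
      refine Finset.sum_congr rfl fun k _ => ?_
      rw [kill_const_mul (hm k), killIter_succ']
      simp only [Nat.add_sub_cancel, Nat.sub_zero, Nat.add_sub_add_right, Nat.sub_sub, add_comm]
    · simp only [killIter, Nat.sub_zero]
      gcongr ENNReal.ofReal ?_ * _
      -- A crossing in the current step leaves `N` generations, whereas the term `k = 0` carries
      -- `decay (N + 1)`; the ratio is at most `3`.
      have h1 := decay_le (show N + 1 + 1 ≤ 2 * (N + 1) by omega)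
      have h2 := decay_pos (N + 1)
      nlinarith [mul_le_mul_of_nonneg_left h1 hK0.le, mul_nonneg hC h2.le]

/-- The value function of a homogeneous stretch of `N` generations with step size `σ`. -/
theorem exists_foldr_replicate_le {σ ρ C : ℝ} (hσ : 0 < σ) (hρ : g / σ < ρ) (hC : 0 ≤ C) :
    ∃ C' : ℝ, 0 < C' ∧ ∀ (N : ℕ) (v : ℝ≥0) (f : ℝ → ℝ≥0∞) (β : ℝ), (v : ℝ) = σ ^ 2 →
      Measurable f → (∀ s, f s ≤ ENNReal.ofReal (C * Real.exp (ρ * (s - β)))) → ∀ y, 0 < y →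
        (List.replicate N v).foldr branchStep f
          (β - (g * σ * N - 3 * σ / (2 * g) * Real.log (N + 1)) - σ * y) ≤
            ENNReal.ofReal (C' * (y + 2) * Real.exp (-(g * y))) := by
  have hg := g_pos
  -- The surplus of the rate `ρ` over the critical one, in units of the step size.
  have hη : 0 < ρ * σ - g := sub_pos.2 ((div_lt_iff₀ hσ).1 hρ)
  set η := ρ * σ - g with hηdef
  obtain ⟨C₁, hC₁, hkill⟩ := exists_killIter_exp_le (c := 3 / (2 * g)) (by positivity) hη
  obtain ⟨C₂, hC₂, hconv⟩ := exists_sum_decay_mul_decay_le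
  set K := C + 3 * Real.exp (η * (3 / (2 * g)) + η ^ 2 / 2) with hK
  have hK0 : 0 < K := by positivity
  refine ⟨K * C₁ * C₂, by positivity, fun N v f β hv hf h0 y hy => ?_⟩
  have h1 := tiltedValue_le_sum σ β hf hv hη hC (fun y => (h0 _).trans (le_of_eq (by
    congr 3; rw [hηdef]; ring))) N hy
  have h2 : ∀ k ∈ Finset.range (N + 1), ENNReal.ofReal (K * decay (N - k)) *
      killIter (fun i => -barrierDrift (N - 1 - i)) k
        (fun u => ENNReal.ofReal (Real.exp (-(η * u)))) y ≤
      ENNReal.ofReal (K * C₁ * (y + 2) * (decay (N - k) * decay k)) := by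
    intro k hk
    have hkN := Finset.mem_range.1 hk
    have h3 := hkill k (fun i => -barrierDrift (N - 1 - i))
      (fun i _ => neg_nonpos.2 (barrierDrift_nonneg _)) (fun r hr => ?_) y hy
    · refine (mul_le_mul_right h3 _).trans (le_of_eq ?_)
      rw [← ENNReal.ofReal_mul (mul_nonneg hK0.le (decay_pos _).le)]
      congr 1
      rw [decay.eq_1 k]
      ring
    · rw [neg_neg]
      refine (barrierDrift_le _).trans ?_
      -- After reversal, the `r`-th drift belongs to a step with at least `r` generations left, so
      -- it is at most `c / (r + 1)` whatever `N` is.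
      have : r ≤ N - 1 - (k - 1 - r) := by omega
      gcongr
  have h3 := h1.trans (Finset.sum_le_sum h2)
  rw [← ENNReal.ofReal_sum_of_nonneg fun k _ => mul_nonneg (by positivity)
    (mul_nonneg (decay_pos _).le (decay_pos _).le), ← Finset.mul_sum] at h3
  have h4 := h3.trans (ENNReal.ofReal_le_ofReal (mul_le_mul_of_nonneg_left (hconv N)
    (show 0 ≤ K * C₁ * (y + 2) by positivity)))
  have hd := decay_pos N
  have h5 := mul_le_mul_right h4 (ENNReal.ofReal ((decay N)⁻¹ * Real.exp (-(g * y))))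
  rw [tiltedValue, ← mul_assoc, ← mul_assoc, ← ENNReal.ofReal_mul (by positivity),
    ← ENNReal.ofReal_mul (by positivity), ← ENNReal.ofReal_mul (by positivity)] at h5
  have h6 : (decay N)⁻¹ * Real.exp (-(g * y)) * decay N * Real.exp (g * y) = 1 := by
    rw [Real.exp_neg]
    field_simp
  rw [h6, ENNReal.ofReal_one, one_mul] at h5
  refine h5.trans (le_of_eq ?_)
  congr 1
  field_simp

/-! ### A stretch controlled by its total variance -/

/-- The plain first moment: without truncation the list of variances enters only through its length
and its sum. -/
lemma foldr_branchStep_le {f : ℝ → ℝ≥0∞} (hf : Measurable f) (l : List ℝ≥0) (s : ℝ) :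
    l.foldr branchStep f s ≤ 2 ^ l.length * ∫⁻ u, f u ∂gaussianReal s l.sum := by
  induction l generalizing s with
  | nil => simp [gaussianReal_zero_var, lintegral_dirac' _ hf]
  | cons v l ih =>
    rw [List.foldr_cons, List.sum_cons, List.length_cons, ← lintegral_lintegral_gaussianReal hf,
      pow_succ', mul_assoc, ← lintegral_const_mul _ (measurable_lintegral_gaussianReal hf _)]
    exact mul_le_mul_right (lintegral_mono fun u => (min_le_right _ _).trans (ih u)) _

lemma lintegral_exp_neg_abs_sub {η : ℝ} (β : ℝ) :
    ∫⁻ u, ENNReal.ofReal (Real.exp (-(η * |u - β|))) =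
      ∫⁻ u, ENNReal.ofReal (Real.exp (-(η * |u|))) :=
  lintegral_sub_right_eq_self (fun u => ENNReal.ofReal (Real.exp (-(η * |u|)))) β

lemma lintegral_exp_neg_abs_lt_top {η : ℝ} (hη : 0 < η) :
    ∫⁻ u, ENNReal.ofReal (Real.exp (-(η * |u|))) < ⊤ := by
  have h1 : IntegrableOn (fun u : ℝ => Real.exp (-(η * |u|))) (Ioi 0) :=
    (integrableOn_exp_mul_Ioi (neg_lt_zero.2 hη) 0).congr_fun
      (fun u hu => by simp [abs_of_pos (mem_Ioi.1 hu)]) measurableSet_Ioi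
  have h2 : IntegrableOn (fun u : ℝ => Real.exp (-(η * |u|))) (Iic 0) :=
    (integrableOn_exp_mul_Iic hη 0).congr_fun
      (fun u hu => by simp [abs_of_nonpos (mem_Iic.1 hu)]) measurableSet_Iic
  have h3 := h2.union h1
  rw [Iic_union_Ioi, integrableOn_univ] at h3
  exact h3.lintegral_lt_top

/-- Tilting the first moment by the critical rate `θ = g / σ` leaves a payoff integrable around `β`.
The bounded Gaussian density then contributes `(N + 1)^(-1/2)`, which is the logarithmic term with
coefficient `1`. The upper bound on the total variance controls the exponent and the lower bound
controls the density. -/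
theorem exists_foldr_le_of_sum_le {σ ρ C κ K : ℝ} (hσ : 0 < σ) (hρ : g / σ < ρ) (hC : 1 ≤ C)
    (hκ : 0 < κ) :
    ∃ C' : ℝ, 0 < C' ∧ ∀ (l : List ℝ≥0) (f : ℝ → ℝ≥0∞) (β : ℝ),
      (l.sum : ℝ) ≤ σ ^ 2 * l.length + K → κ * l.length ≤ l.sum → Measurable f → (∀ s, f s ≤ 1) →
      (∀ s, f s ≤ ENNReal.ofReal (C * Real.exp (ρ * (s - β)))) → ∀ s,
        l.foldr branchStep f s ≤ ENNReal.ofReal (C' * Real.exp (-(g / σ *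
          (β - (g * σ * l.length - σ / (2 * g) * Real.log (l.length + 1)) - s)))) := by
  have hg := g_pos
  set θ := g / σ with hθ
  have hθ0 : 0 < θ := by positivity
  -- After the tilt by `θ`, the terminal bound decays at rate `ρ - θ` below `β`, and the bound by
  -- `1` decays at rate `θ` above it.
  set η := min (ρ - θ) θ with hη
  have hη0 : 0 < η := lt_min (sub_pos.2 hρ) hθ0
  set J := (∫⁻ u, ENNReal.ofReal (Real.exp (-(η * |u|)))).toReal with hJ
  have hJ' : ∫⁻ u, ENNReal.ofReal (Real.exp (-(η * |u|))) = ENNReal.ofReal J :=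
    (ENNReal.ofReal_toReal (lintegral_exp_neg_abs_lt_top hη0).ne).symm
  have hJ0 : 0 ≤ J := ENNReal.toReal_nonneg
  refine ⟨C * (1 + Real.exp (Real.log 2 * (K / σ ^ 2)) * J * (√(κ / 2))⁻¹), by positivity,
    fun l f β hle hge hf hf1 hfe s => ?_⟩
  have hbound : ∀ u, f u ≤ ENNReal.ofReal (C * Real.exp (-(θ * β))) *
      (ENNReal.ofReal (Real.exp (θ * u)) * ENNReal.ofReal (Real.exp (-(η * |u - β|)))) := by
    intro u
    rw [← ENNReal.ofReal_mul (Real.exp_nonneg _), ← ENNReal.ofReal_mul (by positivity), mul_assoc,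
      ← Real.exp_add, ← Real.exp_add]
    rcases le_total u β with h | h
    · refine (hfe u).trans (ENNReal.ofReal_le_ofReal ?_)
      rw [abs_of_nonpos (by linarith)]
      gcongr
      nlinarith [mul_le_mul_of_nonneg_right (min_le_left (ρ - θ) θ) (sub_nonneg.2 h)]
    · refine (hf1 u).trans ?_
      rw [← ENNReal.ofReal_one]
      refine ENNReal.ofReal_le_ofReal ?_
      rw [abs_of_nonneg (by linarith)]
      refine one_le_mul_of_one_le_of_one_le hC (Real.one_le_exp ?_)
      nlinarith [mul_le_mul_of_nonneg_right (min_le_right (ρ - θ) θ) (sub_nonneg.2 h)]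
  -- The empty list has variance `0` and no density, so it is treated directly.
  rcases l.eq_nil_or_concat' with rfl | ⟨l', a, hl'⟩
  · refine (hbound s).trans ?_
    rw [← ENNReal.ofReal_mul (Real.exp_nonneg _), ← ENNReal.ofReal_mul (by positivity)]
    refine ENNReal.ofReal_le_ofReal ?_
    have h1 : Real.exp (-(η * |s - β|)) ≤ 1 :=
      Real.exp_le_one_iff.2 (neg_nonpos.2 (by positivity))
    have h2 : Real.exp (-(θ * (β - s))) = Real.exp (-(θ * β)) * Real.exp (θ * s) := by
      rw [← Real.exp_add]
      congr 1
      ring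
    simp only [List.length_nil, Nat.cast_zero, mul_zero, zero_add, Real.log_one, sub_zero]
    rw [h2]
    have h3 : 0 ≤ C * Real.exp (-(θ * β)) * Real.exp (θ * s) := by positivity
    have h4 : 0 ≤ Real.exp (Real.log 2 * (K / σ ^ 2)) * J * (√(κ / 2))⁻¹ := by positivity
    nlinarith [mul_nonneg h3 h4, mul_le_mul_of_nonneg_left h1 h3]
  · have hN : 1 ≤ l.length := by rw [hl']; simp
    clear hl'
    set N := l.length
    set V := l.sum
    have hN' : (1 : ℝ) ≤ N := by exact_mod_cast hN
    have hV0 : (0 : ℝ) < V := lt_of_lt_of_le (by positivity) hge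
    have hVne : V ≠ 0 := by
      intro h
      rw [h] at hV0
      simp at hV0
    refine (foldr_branchStep_le hf l s).trans ((mul_le_mul_right (lintegral_mono hbound) _).trans ?_)
    rw [lintegral_const_mul _ (by fun_prop), lintegral_exp_mul_gaussianReal (by fun_prop)]
    refine (mul_le_mul_right (mul_le_mul_right (mul_le_mul_right
      (lintegral_gaussianReal_le (by fun_prop) _ hVne) _) _) _).trans ?_
    rw [lintegral_exp_neg_abs_sub, hJ', show (2 : ℝ≥0∞) ^ l.length = ENNReal.ofReal (2 ^ N) by
        rw [ENNReal.ofReal_pow zero_le_two, ENNReal.ofReal_ofNat],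
      ← ENNReal.ofReal_mul (by positivity), ← ENNReal.ofReal_mul (by positivity),
      ← ENNReal.ofReal_mul (by positivity), ← ENNReal.ofReal_mul (by positivity)]
    refine ENNReal.ofReal_le_ofReal ?_
    have hsq : (√(2 * Real.pi * V))⁻¹ ≤ (√(κ / 2))⁻¹ * Real.exp (-(1 / 2 * Real.log (N + 1))) := by
      have h1 : Real.exp (-(1 / 2 * Real.log ((N : ℝ) + 1))) = (√((N : ℝ) + 1))⁻¹ := by
        rw [Real.exp_neg, Real.sqrt_eq_rpow, Real.rpow_def_of_pos (by positivity), mul_comm]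
      rw [h1, ← mul_inv, ← Real.sqrt_mul (by positivity)]
      have h2 : κ / 2 * (N + 1) ≤ 2 * Real.pi * V := by
        have : κ / 2 * (N + 1) ≤ κ * N := by nlinarith
        nlinarith [Real.pi_gt_three]
      gcongr
    -- Since `θ² / 2 = log 2 / σ²`, the tilting cost is `2 ^ (V / σ²)`, that is `2 ^ N` up to the
    -- bounded excess `K / σ²`.
    have hexp : (2 : ℝ) ^ N * Real.exp (θ ^ 2 * V / 2) ≤
        Real.exp (Real.log 2 * (K / σ ^ 2)) * Real.exp (g ^ 2 * N) := by
      have h1 : (2 : ℝ) ^ N = Real.exp (Real.log 2 * N) := by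
        rw [mul_comm, Real.exp_nat_mul, Real.exp_log two_pos]
      rw [h1, ← Real.exp_add, ← Real.exp_add]
      refine Real.exp_le_exp.2 ?_
      have h2 : θ ^ 2 * V / 2 = Real.log 2 * (V / σ ^ 2) := by
        rw [hθ, div_pow, g_sq]
        ring
      have h3 : (V : ℝ) / σ ^ 2 ≤ N + K / σ ^ 2 := by
        rw [div_le_iff₀ (by positivity), add_mul, div_mul_cancel₀ _ (by positivity)]
        linarith
      have h4 := mul_le_mul_of_nonneg_left h3 (Real.log_nonneg one_le_two)
      rw [h2, g_sq]
      linarith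
    have hid : Real.exp (-(θ * (β - (g * σ * N - σ / (2 * g) * Real.log (N + 1)) - s))) =
        Real.exp (-(θ * β)) * Real.exp (θ * s) * Real.exp (g ^ 2 * N) *
          Real.exp (-(1 / 2 * Real.log (N + 1))) := by
      rw [← Real.exp_add, ← Real.exp_add, ← Real.exp_add]
      congr 1
      rw [hθ]
      field_simp
      ring
    rw [hid, Real.exp_add]
    set X := Real.exp (-(θ * β)) * Real.exp (θ * s) with hX
    have hX0 : 0 < X := by positivity
    set L := Real.exp (-(1 / 2 * Real.log ((N : ℝ) + 1))) with hL
    calc (2 : ℝ) ^ N * (C * Real.exp (-(θ * β)) * (Real.exp (θ * s) * Real.exp (θ ^ 2 * V / 2) *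
          ((√(2 * Real.pi * V))⁻¹ * J)))
        = C * X * J * ((2 : ℝ) ^ N * Real.exp (θ ^ 2 * V / 2)) * (√(2 * Real.pi * V))⁻¹ := by
          rw [hX]
          ring
      _ ≤ C * X * J * (Real.exp (Real.log 2 * (K / σ ^ 2)) * Real.exp (g ^ 2 * N)) *
          ((√(κ / 2))⁻¹ * L) := by gcongr
      _ = C * (Real.exp (Real.log 2 * (K / σ ^ 2)) * J * (√(κ / 2))⁻¹) *
          (X * Real.exp (g ^ 2 * N) * L) := by ring
      _ ≤ _ := by gcongr; linarith

namespace Profile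

/-! ### The variance profile and its concave hull -/

lemma exists_Ioc (P : Profile) {s : ℝ} (hs : s ∈ Ioc (0 : ℝ) 1) :
    ∃ i : Fin P.M, s ∈ Ioc (P.lam i.castSucc) (P.lam i.succ) := by
  by_contra! hc
  have key : ∀ k : Fin (P.M + 1), P.lam k < s := by
    intro k
    induction k using Fin.induction with
    | zero => rw [P.lam_zero]; exact hs.1
    | succ i ih =>
      by_contra! h
      exact hc i ⟨ih, h⟩
  have := key (Fin.last P.M)
  rw [P.lam_last] at this
  linarith [hs.2]

lemma lam_castSucc_lt (P : Profile) (i : Fin P.M) : P.lam i.castSucc < P.lam i.succ :=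
  P.lam_strictMono Fin.castSucc_lt_succ

/-- An upper bound of the squared step function. -/
noncomputable def sqBound (P : Profile) : ℝ := ∑ i, P.σ i ^ 2

lemma sq_le_sqBound (P : Profile) (i : Fin P.M) : P.σ i ^ 2 ≤ P.sqBound :=
  Finset.single_le_sum (f := fun i => P.σ i ^ 2) (fun _ _ => sq_nonneg _) (Finset.mem_univ i)

lemma sqBound_nonneg (P : Profile) : 0 ≤ P.sqBound := Finset.sum_nonneg fun _ _ => sq_nonneg _

lemma J_sub (P : Profile) (s t : ℝ) : P.J t - P.J s = ∫ r in s..t, P.step r ^ 2 :=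
  intervalIntegral.integral_interval_sub_left (P.step_sq_intervalIntegrable _ _)
    (P.step_sq_intervalIntegrable _ _)

lemma J_sub_le_of_step_le (P : Profile) {s t c : ℝ} (hst : s ≤ t)
    (h : ∀ r ∈ Ioo s t, P.step r ^ 2 ≤ c) : P.J t - P.J s ≤ c * (t - s) := by
  rw [P.J_sub]
  refine (intervalIntegral.integral_mono_on_of_le_Ioo hst (P.step_sq_intervalIntegrable _ _)
    intervalIntegrable_const h).trans (le_of_eq ?_)
  rw [intervalIntegral.integral_const, smul_eq_mul, mul_comm]

lemma le_J_sub_of_le_step (P : Profile) {s t c : ℝ} (hst : s ≤ t)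
    (h : ∀ r ∈ Ioo s t, c ≤ P.step r ^ 2) : c * (t - s) ≤ P.J t - P.J s := by
  rw [P.J_sub]
  refine le_trans (le_of_eq ?_) (intervalIntegral.integral_mono_on_of_le_Ioo hst
    intervalIntegrable_const (P.step_sq_intervalIntegrable _ _) h)
  rw [intervalIntegral.integral_const, smul_eq_mul, mul_comm]

lemma J_mono (P : Profile) {s t : ℝ} (hst : s ≤ t) : P.J s ≤ P.J t := by
  have := P.le_J_sub_of_le_step hst fun r _ => sq_nonneg _
  linarith

lemma J_sub_le (P : Profile) {s t : ℝ} (hs : 0 ≤ s) (hst : s ≤ t) (ht : t ≤ 1) :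
    P.J t - P.J s ≤ P.sqBound * (t - s) := by
  refine P.J_sub_le_of_step_le hst fun r hr => ?_
  obtain ⟨i, hi⟩ := P.exists_Ioc (s := r) ⟨by linarith [hr.1], by linarith [hr.2]⟩
  rw [P.step_eq i hi]
  exact P.sq_le_sqBound i

lemma concaveOn_of_exists_supergradient {f : ℝ → ℝ} {s : Set ℝ} (hs : Convex ℝ s)
    (h : ∀ p ∈ s, ∃ c, ∀ x ∈ s, f x ≤ f p + c * (x - p)) : ConcaveOn ℝ s f := by
  refine ⟨hs, fun x hx y hy a b ha hb hab => ?_⟩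
  obtain ⟨c, hc⟩ := h _ (hs hx hy ha hb hab)
  have h1 := mul_le_mul_of_nonneg_left (hc x hx) ha
  have h2 := mul_le_mul_of_nonneg_left (hc y hy) hb
  simp only [smul_eq_mul] at *
  obtain rfl : b = 1 - a := by linarith
  nlinarith

/-- The tangent lines of a concave profile. -/
lemma J_le_of_strictAnti (Q : Profile) (hQ : StrictAnti Q.σ) (j : Fin Q.M) {p s : ℝ}
    (hp : p ∈ Icc (Q.lam j.castSucc) (Q.lam j.succ)) (hs : s ∈ Icc (0 : ℝ) 1) :
    Q.J s ≤ Q.J p + Q.σ j ^ 2 * (s - p) := by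
  have hlo := (Q.lam_mem j.castSucc).1
  have hhi := (Q.lam_mem j.succ).2
  rcases le_total p s with h | h
  · have := Q.J_sub_le_of_step_le h (c := Q.σ j ^ 2) fun r hr => by
      obtain ⟨i, hi⟩ := Q.exists_Ioc (s := r) ⟨by linarith [hr.1, hp.1], by linarith [hr.2, hs.2]⟩
      rw [Q.step_eq i hi]
      have hij : j ≤ i := by
        by_contra! hlt
        have : Q.lam i.succ ≤ Q.lam j.castSucc := Q.lam_strictMono.monotone hlt
        linarith [hi.2, hr.1, hp.1]
      exact pow_le_pow_left₀ (Q.σ_pos i).le (hQ.antitone hij) 2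
    linarith
  · have := Q.le_J_sub_of_le_step h (c := Q.σ j ^ 2) fun r hr => by
      obtain ⟨i, hi⟩ := Q.exists_Ioc (s := r) ⟨by linarith [hr.1, hs.1], by linarith [hr.2, hp.2]⟩
      rw [Q.step_eq i hi]
      have hij : i ≤ j := by
        by_contra! hlt
        have : Q.lam j.succ ≤ Q.lam i.castSucc := Q.lam_strictMono.monotone hlt
        linarith [hi.1, hr.2, hp.2]
      exact pow_le_pow_left₀ (Q.σ_pos j).le (hQ.antitone hij) 2
    linarith

lemma concaveOn_J (Q : Profile) (hQ : StrictAnti Q.σ) : ConcaveOn ℝ (Icc 0 1) Q.J :=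
  concaveOn_of_exists_supergradient (convex_Icc 0 1) fun _ hp => by
    obtain ⟨j, hj⟩ := Q.exists_interval hp
    exact ⟨_, fun x hx => Q.J_le_of_strictAnti hQ j hj hx⟩

variable {P Q : Profile}

lemma IsEffective.J_le (h : P.IsEffective Q) {s : ℝ} (hs : s ∈ Icc (0 : ℝ) 1) : P.J s ≤ Q.J s := by
  rw [← h.2 s hs]
  refine le_csInf ⟨_, fun _ => P.J 1, concaveOn_const _ (convex_Icc 0 1),
    fun r hr => P.J_mono hr.2, rfl⟩ ?_
  rintro y ⟨h, -, hh, rfl⟩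
  exact hh s hs

lemma IsEffective.J_le_of_concaveOn (h : P.IsEffective Q) {f : ℝ → ℝ}
    (hf : ConcaveOn ℝ (Icc 0 1) f) (hPf : ∀ r ∈ Icc (0 : ℝ) 1, P.J r ≤ f r) {s : ℝ}
    (hs : s ∈ Icc (0 : ℝ) 1) : Q.J s ≤ f s := by
  rw [← h.2 s hs]
  refine csInf_le ⟨P.J s, ?_⟩ ⟨f, hf, hPf, rfl⟩
  rintro y ⟨h, -, hh, rfl⟩
  exact hh s hs

/-- The concave hull touches the function wherever it has a kink. -/
lemma IsEffective.J_eq_of_kink (h : P.IsEffective Q) {p a b : ℝ} (hp : p ∈ Icc (0 : ℝ) 1)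
    (hab : b < a) (ha : ∀ s ∈ Icc (0 : ℝ) 1, Q.J s ≤ Q.J p + a * (s - p))
    (hb : ∀ s ∈ Icc (0 : ℝ) 1, Q.J s ≤ Q.J p + b * (s - p)) : P.J p = Q.J p := by
  refine le_antisymm (h.J_le hp) ?_
  by_contra! hlt
  set m := (a + b) / 2 with hm
  set K := P.sqBound with hK
  have hK0 : 0 ≤ K := P.sqBound_nonneg
  set R := 1 + 2 * (K + |m|) / (a - b) with hR
  have hR0 : 0 < R := by
    have : 0 ≤ 2 * (K + |m|) / (a - b) := div_nonneg (by positivity) (by linarith)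
    linarith
  -- Cut the corner at `p` with a line of intermediate slope lowered by `ε`. It can lie below `Q.J`
  -- only where `|r - p| < 2 ε / (a - b)`. There the Lipschitz bound keeps `P.J` below the line, by
  -- the choice of `R`. The minimum of `Q.J` and the line is then a smaller concave majorant.
  set ε := (Q.J p - P.J p) / R with hε
  have hε0 : 0 < ε := div_pos (by linarith) hR0
  have hεR : ε * R = Q.J p - P.J p := div_mul_cancel₀ _ hR0.ne'
  have hline : ConcaveOn ℝ (Icc (0 : ℝ) 1) fun s => Q.J p - ε + m * (s - p) :=
    concaveOn_of_exists_supergradient (convex_Icc 0 1) fun q _ => ⟨m, fun x _ => by linarith⟩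
  have hmaj : ∀ r ∈ Icc (0 : ℝ) 1, P.J r ≤ Q.J p - ε + m * (r - p) ∨
      Q.J r ≤ Q.J p - ε + m * (r - p) := by
    intro r hr
    by_contra! hc
    obtain ⟨h1, h2⟩ := hc
    have h3 := ha r hr
    have h4 := hb r hr
    have h5 : (a - b) * |r - p| < 2 * ε := by
      rcases abs_cases (r - p) with ⟨h, _⟩ | ⟨h, _⟩ <;> rw [h] <;> nlinarith
    have h6 : P.J r ≤ P.J p + K * |r - p| := by
      rcases le_total r p with hle | hle
      · have := P.J_mono hle
        have := mul_nonneg hK0 (abs_nonneg (r - p))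
        linarith
      · have := P.J_sub_le hp.1 hle hr.2
        rw [abs_of_nonneg (by linarith)]
        linarith
    have h7 : -(|m| * |r - p|) ≤ m * (r - p) := by
      rw [← abs_mul]
      exact neg_abs_le _
    have h8 : (K + |m|) * |r - p| ≤ (K + |m|) * (2 * ε / (a - b)) := by
      refine mul_le_mul_of_nonneg_left ?_ (by positivity)
      rw [le_div_iff₀ (by linarith)]
      linarith
    have h9 : ε * R = ε + (K + |m|) * (2 * ε / (a - b)) := by
      rw [hR]
      ring
    nlinarith
  have hle := h.J_le_of_concaveOn ((Q.concaveOn_J h.1).inf hline) (fun r hr => by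
    rcases hmaj r hr with h1 | h1
    · exact le_inf (h.J_le hr) h1
    · exact (h.J_le hr).trans (le_inf le_rfl h1)) hp
  have := hle.trans inf_le_right
  simp only [sub_self, mul_zero, add_zero] at this
  linarith

/-- Interior effective scales are kinks, with the distinct slopes of the two adjacent stretches as
supergradients. Both functions vanish at `0`. -/
lemma IsEffective.J_lam_eq (h : P.IsEffective Q) (k : Fin (Q.M + 1)) :
    P.J (Q.lam k) = Q.J (Q.lam k) := by
  refine Fin.cases ?_ (fun j => ?_) k
  · rw [Q.lam_zero, P.J_zero, Q.J_zero]
  · have hp := Q.lam_mem j.succ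
    have hj : Q.lam j.succ ∈ Icc (Q.lam j.castSucc) (Q.lam j.succ) :=
      right_mem_Icc.2 (Q.lam_castSucc_lt j).le
    have ha : ∀ s ∈ Icc (0 : ℝ) 1, Q.J s ≤ Q.J (Q.lam j.succ) + Q.σ j ^ 2 * (s - Q.lam j.succ) :=
      fun s hs => Q.J_le_of_strictAnti h.1 j hj hs
    by_cases hlast : j.succ = Fin.last Q.M
    · refine h.J_eq_of_kink hp (sub_one_lt (Q.σ j ^ 2)) ha fun s hs => ?_
      have h1 := ha s hs
      rw [hlast, Q.lam_last] at h1 ⊢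
      nlinarith [hs.2]
    · have hlt : (j : ℕ) + 1 < Q.M := by
        have h1 := j.2
        have h2 : (j : ℕ) + 1 ≠ Q.M := fun h => hlast (Fin.ext h)
        omega
      have hsucc : j.succ = (⟨j + 1, hlt⟩ : Fin Q.M).castSucc := rfl
      have hj' : Q.lam j.succ ∈ Icc (Q.lam (⟨j + 1, hlt⟩ : Fin Q.M).castSucc)
          (Q.lam (⟨j + 1, hlt⟩ : Fin Q.M).succ) := by
        rw [hsucc]
        exact left_mem_Icc.2 (Q.lam_castSucc_lt _).le
      have hσ : Q.σ ⟨j + 1, hlt⟩ < Q.σ j := h.1 (by simp [Fin.lt_def])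
      exact h.J_eq_of_kink hp (pow_lt_pow_left₀ hσ (Q.σ_pos _).le two_ne_zero) ha
        fun s hs => Q.J_le_of_strictAnti h.1 _ hj' hs

/-! ### The generations of the walk -/

/-- The step size of the walk of length `n` from generation `k` to generation `k + 1`. -/
noncomputable def stepSize (P : Profile) (n k : ℕ) : ℝ := P.step ((k + 1) / n)

lemma exists_stepSize_eq (P : Profile) {n k : ℕ} (hk : k < n) : ∃ i : Fin P.M,
    ((k : ℝ) + 1) / n ∈ Ioc (P.lam i.castSucc) (P.lam i.succ) ∧ P.stepSize n k = P.σ i := by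
  have hn : (0 : ℝ) < n := by exact_mod_cast (Nat.zero_le k).trans_lt hk
  have hk' : (k : ℝ) + 1 ≤ n := by exact_mod_cast hk
  obtain ⟨i, hi⟩ := P.exists_Ioc (s := ((k : ℝ) + 1) / n)
    ⟨by positivity, (div_le_one hn).2 hk'⟩
  exact ⟨i, hi, P.step_eq i hi⟩

/-- Generation `k + 1` lies between the two floors exactly when `(k + 1) / n` lies in the half-open
interval. As this ratio is positive, the value of the step function at `0` plays no role. -/
lemma walk_eq_endpoint (P : Profile) {n : ℕ} {Ω : Type*} (Z : Vertex n → Ω → ℝ) (v : Particle n)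
    (ω : Ω) : walk P Z v n ω = endpoint (fun k => P.stepSize n k) (fun w => Z w ω) v := by
  unfold walk endpoint
  simp only [Finset.sum_filter]
  rw [Finset.sum_comm]
  refine Finset.sum_congr rfl fun k _ => ?_
  have hn : (0 : ℝ) < n := by exact_mod_cast (Nat.zero_le _).trans_lt k.2
  have hne : ((k : ℝ) + 1) / n ∉ ({0} : Set ℝ) := by
    rw [mem_singleton_iff]
    positivity
  unfold stepSize step
  rw [indicator_of_notMem hne, zero_add, Finset.sum_mul]
  refine Finset.sum_congr rfl fun i _ => ?_
  have h0 := (P.lam_mem i.castSucc).1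
  have h1 := (P.lam_mem i.succ).1
  have hiff : (⌊P.lam i.castSucc * n⌋₊ + 1 ≤ (k : ℕ) + 1 ∧
      (k : ℕ) + 1 ≤ min ⌊P.lam i.succ * n⌋₊ n) ↔
        ((k : ℝ) + 1) / n ∈ Ioc (P.lam i.castSucc) (P.lam i.succ) := by
    rw [mem_Ioc, lt_div_iff₀ hn, div_le_iff₀ hn, le_min_iff, Nat.succ_le_iff,
      Nat.floor_lt (by positivity), Nat.le_floor_iff (by positivity)]
    push_cast
    have : (k : ℕ) + 1 ≤ n := k.2
    tauto
  by_cases hc : ((k : ℝ) + 1) / n ∈ Ioc (P.lam i.castSucc) (P.lam i.succ)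
  · rw [if_pos (hiff.2 hc), indicator_of_mem hc]
  · rw [if_neg (fun h => hc (hiff.1 h)), indicator_of_notMem hc, zero_mul]

/-- On a cell `[k/n, (k+1)/n]` inside one interval of constancy the squared step is exactly `n`
times the increment of `J`. Otherwise a breakpoint `λ_i` with `⌊λ_i n⌋ = k` lies in the cell, and
the error is at most `sqBound`. Summed over `k`, each breakpoint counts at most once. -/
lemma stepSize_sq_le (P : Profile) {n k : ℕ} (hk : k < n) :
    P.stepSize n k ^ 2 ≤ n * (P.J ((k + 1 : ℕ) / n) - P.J (k / n)) +
      P.sqBound * ∑ i, (if ⌊P.lam i * n⌋₊ = k then 1 else 0) := by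
  have hn : (0 : ℝ) < n := by exact_mod_cast (Nat.zero_le _).trans_lt hk
  obtain ⟨i, hi, hσ⟩ := P.exists_stepSize_eq hk
  rw [hσ]
  have hsum : (0 : ℝ) ≤ ∑ i, (if ⌊P.lam i * n⌋₊ = k then 1 else 0) :=
    Finset.sum_nonneg fun i _ => by split_ifs <;> norm_num
  have hK := P.sqBound_nonneg
  push_cast
  have hkk : (k : ℝ) / n ≤ (k + 1) / n := by gcongr; linarith
  rcases le_or_gt (P.lam i.castSucc) (k / n) with h | h
  · have h1 := P.J_affine i (s := (k : ℝ) / n) ⟨h, hkk.trans hi.2⟩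
    have h2 := P.J_affine i (s := ((k : ℝ) + 1) / n) ⟨hi.1.le, hi.2⟩
    rw [h1, h2]
    have h3 : (n : ℝ) * (P.J (P.lam i.castSucc) + P.σ i ^ 2 * (((k : ℝ) + 1) / n -
        P.lam i.castSucc) - (P.J (P.lam i.castSucc) + P.σ i ^ 2 * ((k : ℝ) / n -
          P.lam i.castSucc))) = P.σ i ^ 2 := by
      field_simp
      ring
    rw [h3]
    have := mul_nonneg hK hsum
    linarith
  · have hfl : ⌊P.lam i.castSucc * n⌋₊ = k := by
      rw [Nat.floor_eq_iff (mul_nonneg (P.lam_mem _).1 hn.le)]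
      exact ⟨((div_lt_iff₀ hn).1 h).le, (lt_div_iff₀ hn).1 hi.1⟩
    have h1 : (1 : ℝ) ≤ ∑ i, (if ⌊P.lam i * n⌋₊ = k then 1 else 0) := by
      have := Finset.single_le_sum (f := fun i => if ⌊P.lam i * n⌋₊ = k then (1 : ℝ) else 0)
        (fun i _ => by split_ifs <;> norm_num) (Finset.mem_univ i.castSucc)
      simpa [hfl] using this
    have h2 := P.sq_le_sqBound i
    have h3 := mul_nonneg hn.le (sub_nonneg.2 (P.J_mono hkk))
    nlinarith

lemma sum_stepSize_sq_le (P : Profile) {n p q : ℕ} (hpq : p ≤ q) (hq : q ≤ n) :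
    ∑ k ∈ Finset.Ico p q, P.stepSize n k ^ 2 ≤
      n * (P.J (q / n) - P.J (p / n)) + P.sqBound * (P.M + 1) := by
  refine (Finset.sum_le_sum fun k hk =>
    P.stepSize_sq_le (lt_of_lt_of_le (Finset.mem_Ico.1 hk).2 hq)).trans ?_
  rw [Finset.sum_add_distrib, ← Finset.mul_sum, ← Finset.mul_sum,
    Finset.sum_Ico_sub (fun k : ℕ => P.J ((k : ℝ) / n)) hpq, Finset.sum_comm]
  have hone : ∀ i : Fin (P.M + 1),
      ∑ k ∈ Finset.Ico p q, (if ⌊P.lam i * n⌋₊ = k then (1 : ℝ) else 0) ≤ 1 := fun i => by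
    rw [Finset.sum_ite_eq]
    split_ifs <;> norm_num
  have hall := Finset.sum_le_sum fun (i : Fin (P.M + 1)) (_ : i ∈ Finset.univ) => hone i
  simp only [Finset.sum_const, Finset.card_univ, Fintype.card_fin, nsmul_eq_mul, mul_one] at hall
  push_cast at hall
  have := mul_le_mul_of_nonneg_left hall P.sqBound_nonneg
  linarith

/-- The generation `⌊λ^j n⌋`. -/
noncomputable def cut (Q : Profile) (n : ℕ) (j : Fin (Q.M + 1)) : ℕ := ⌊Q.lam j * n⌋₊

lemma cut_zero (Q : Profile) (n : ℕ) : Q.cut n 0 = 0 := by simp [cut, Q.lam_zero]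

lemma cut_last (Q : Profile) (n : ℕ) : Q.cut n (Fin.last Q.M) = n := by simp [cut, Q.lam_last]

lemma cut_mono (Q : Profile) (n : ℕ) : Monotone (Q.cut n) := fun i j h => by
  unfold cut
  gcongr
  exact Q.lam_strictMono.monotone h

lemma cut_le (Q : Profile) (n : ℕ) (j : Fin (Q.M + 1)) : Q.cut n j ≤ n := by
  rw [← Q.cut_last n]
  simpa [Q.cut_last n] using Q.cut_mono n (Fin.le_last j)

/-- The number of generations in the `j`-th effective stretch. -/
noncomputable def gens (Q : Profile) (n : ℕ) (j : Fin Q.M) : ℕ :=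
  Q.cut n j.succ - Q.cut n j.castSucc

lemma gens_cast (Q : Profile) (n : ℕ) (j : Fin Q.M) :
    (Q.gens n j : ℝ) = Q.cut n j.succ - Q.cut n j.castSucc :=
  Nat.cast_sub (Q.cut_mono n Fin.castSucc_lt_succ.le)

lemma cut_le_lam_mul (Q : Profile) (n : ℕ) (j : Fin (Q.M + 1)) : (Q.cut n j : ℝ) ≤ Q.lam j * n :=
  Nat.floor_le (mul_nonneg (Q.lam_mem j).1 (Nat.cast_nonneg n))

lemma lam_mul_lt_cut (Q : Profile) (n : ℕ) (j : Fin (Q.M + 1)) :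
    Q.lam j * n < Q.cut n j + 1 := Nat.lt_floor_add_one _

/-- `P.J` and `Q.J` agree at both ends of an effective stretch, so their increments there agree;
rounding the ends to integers and the breakpoints cost only a constant. -/
lemma IsEffective.sum_stepSize_sq_le (h : P.IsEffective Q) (n : ℕ) (j : Fin Q.M) :
    ∑ k ∈ Finset.Ico (Q.cut n j.castSucc) (Q.cut n j.succ), P.stepSize n k ^ 2 ≤
      Q.σ j ^ 2 * Q.gens n j + (Q.σ j ^ 2 + P.sqBound * (P.M + 2)) := by
  have hK := P.sqBound_nonneg
  rcases Nat.eq_zero_or_pos n with rfl | hn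
  · simp only [cut, Nat.cast_zero, mul_zero, Nat.floor_zero, Finset.Ico_self, Finset.sum_empty]
    positivity
  have hn' : (0 : ℝ) < n := by exact_mod_cast hn
  refine (P.sum_stepSize_sq_le (Q.cut_mono n Fin.castSucc_lt_succ.le) (Q.cut_le n _)).trans ?_
  have h1 : P.J (Q.cut n j.succ / n) ≤ P.J (Q.lam j.succ) :=
    P.J_mono ((div_le_iff₀ hn').2 (Q.cut_le_lam_mul n _))
  have h2 : (Q.cut n j.castSucc : ℝ) / n ≤ Q.lam j.castSucc :=
    (div_le_iff₀ hn').2 (Q.cut_le_lam_mul n _)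
  have h3 := P.J_sub_le (by positivity) h2 (Q.lam_mem _).2
  rw [h.J_lam_eq] at h1 h3
  have h4 := Q.J_affine j (right_mem_Icc.2 (Q.lam_castSucc_lt j).le)
  have h5 : n * (P.J (Q.cut n j.succ / n) - P.J (Q.cut n j.castSucc / n)) ≤
      n * (Q.σ j ^ 2 * (Q.lam j.succ - Q.lam j.castSucc) +
        P.sqBound * (Q.lam j.castSucc - Q.cut n j.castSucc / n)) :=
    mul_le_mul_of_nonneg_left (by linarith) hn'.le
  have h6 : n * (Q.σ j ^ 2 * (Q.lam j.succ - Q.lam j.castSucc) +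
        P.sqBound * (Q.lam j.castSucc - Q.cut n j.castSucc / n)) =
      Q.σ j ^ 2 * (Q.lam j.succ * n - Q.lam j.castSucc * n) +
        P.sqBound * (Q.lam j.castSucc * n - Q.cut n j.castSucc) := by
    field_simp
  have h7 : Q.σ j ^ 2 * (Q.lam j.succ * n - Q.lam j.castSucc * n) ≤
      Q.σ j ^ 2 * (Q.gens n j + 1) := by
    refine mul_le_mul_of_nonneg_left ?_ (sq_nonneg _)
    rw [gens_cast]
    linarith [Q.lam_mul_lt_cut n j.succ, Q.cut_le_lam_mul n j.castSucc]
  have h8 : P.sqBound * (Q.lam j.castSucc * n - Q.cut n j.castSucc) ≤ P.sqBound * 1 :=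
    mul_le_mul_of_nonneg_left (by linarith [Q.lam_mul_lt_cut n j.castSucc]) hK
  linarith

lemma stepSize_eq_of_coincide (P : Profile) {n k : ℕ} {j : Fin P.eff.M}
    (hc : P.Coincide (P.eff.lam j.castSucc) (P.eff.lam j.succ))
    (hk : k ∈ Finset.Ico (P.eff.cut n j.castSucc) (P.eff.cut n j.succ)) :
    P.stepSize n k = P.eff.σ j := by
  obtain ⟨hk1, hk2⟩ := Finset.mem_Ico.1 hk
  have hkn : k < n := lt_of_lt_of_le hk2 (P.eff.cut_le n _)
  have hn : (0 : ℝ) < n := by exact_mod_cast (Nat.zero_le _).trans_lt hkn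
  obtain ⟨i, hi, hσ⟩ := P.exists_stepSize_eq hkn
  rw [hσ]
  set s := ((k : ℝ) + 1) / n with hs
  have hs1 : P.eff.lam j.castSucc < s := by
    rw [hs, lt_div_iff₀ hn]
    have : (P.eff.cut n j.castSucc : ℝ) ≤ k := by exact_mod_cast hk1
    linarith [P.eff.lam_mul_lt_cut n j.castSucc]
  have hs2 : s ≤ P.eff.lam j.succ := by
    rw [hs, div_le_iff₀ hn]
    have : (k : ℝ) + 1 ≤ P.eff.cut n j.succ := by exact_mod_cast hk2
    linarith [P.eff.cut_le_lam_mul n j.succ]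
  -- Just to the left of `s`, on `[r, s]`, both functions are affine, so coincidence forces equal
  -- slopes.
  set r := max (P.lam i.castSucc) (P.eff.lam j.castSucc) with hr
  have hrs : r < s := max_lt hi.1 hs1
  have hr1 : P.lam i.castSucc ≤ r := le_max_left _ _
  have hr2 : P.eff.lam j.castSucc ≤ r := le_max_right _ _
  have e1 := P.J_affine i (s := s) ⟨hi.1.le, hi.2⟩
  have e2 := P.J_affine i (s := r) ⟨hr1, hrs.le.trans hi.2⟩
  have e3 := P.eff.J_affine j (s := s) ⟨hs1.le, hs2⟩
  have e4 := P.eff.J_affine j (s := r) ⟨hr2, hrs.le.trans hs2⟩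
  have e5 := hc s ⟨hs1.le, hs2⟩
  have e6 := hc r ⟨hr2, hrs.le.trans hs2⟩
  have e7 : P.σ i ^ 2 * (s - r) = P.eff.σ j ^ 2 * (s - r) := by linarith
  have e8 := mul_right_cancel₀ (sub_pos.2 hrs).ne' e7
  exact (pow_left_inj₀ (P.σ_pos i).le (P.eff.σ_pos j).le two_ne_zero).1 e8

lemma exists_stepSize_sq_ge (P : Profile) : ∃ κ : ℝ, 0 < κ ∧ ∀ n k : ℕ, k < n →
    κ ≤ P.stepSize n k ^ 2 := by
  have : Nonempty (Fin P.M) := ⟨⟨0, P.M_pos⟩⟩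
  obtain ⟨i₀, hi₀⟩ := Finite.exists_min P.σ
  refine ⟨P.σ i₀ ^ 2, pow_pos (P.σ_pos i₀) 2, fun n k hk => ?_⟩
  obtain ⟨i, -, hσ⟩ := P.exists_stepSize_eq hk
  rw [hσ]
  exact pow_le_pow_left₀ (P.σ_pos i₀).le (hi₀ i) 2

/-! ### The centring -/

/-- The displacement of the optimal path along the `j`-th effective stretch, with the number of
generations in place of the effective time. -/
noncomputable def rise (P : Profile) (n : ℕ) (j : Fin P.eff.M) : ℝ :=
  g * P.eff.σ j * P.eff.gens n j -
    (1 + 2 * (P.δ j : ℝ)) * P.eff.σ j / (2 * g) * Real.log (P.eff.gens n j + 1)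

lemma gapTime_pos (P : Profile) {n : ℕ} (hn : 0 < n) (j : Fin P.eff.M) : 0 < P.gapTime n j := by
  have hn' : (0 : ℝ) < n := by exact_mod_cast hn
  unfold gapTime effTime
  nlinarith [P.eff.lam_castSucc_lt j]

lemma optimalPath_self (P : Profile) {n : ℕ} (hn : 0 < n) :
    P.optimalPath n n = ∑ j, (g * P.eff.σ j * P.gapTime n j -
      (1 + 2 * (P.δ j : ℝ)) * P.eff.σ j / (2 * g) * Real.log (P.gapTime n j)) := by
  have hn' : (0 : ℝ) < n := by exact_mod_cast hn
  unfold optimalPath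
  rw [Finset.filter_true_of_mem fun j _ => ?_]
  · refine Finset.sum_congr rfl fun j _ => ?_
    have h1 : P.effTime n j.succ ≤ n := by
      unfold effTime
      nlinarith [(P.eff.lam_mem j.succ).2]
    rw [min_eq_right h1]
    have h2 := P.gapTime_pos hn j
    rw [show P.effTime n j.succ - P.effTime n j.castSucc = P.gapTime n j from rfl,
      div_self h2.ne', one_mul]
  · unfold effTime
    have := P.eff.lam_castSucc_lt j
    have := (P.eff.lam_mem j.succ).2
    nlinarith

/-- `gapTime` differs from `gens` by at most `1`. The linear term thus loses at most `g σ̄_j`, and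
the `+ 1` inside the logarithm of `rise` makes the logarithmic terms compare in the right direction.
-/
lemma sum_rise_le_optimalPath (P : Profile) {n : ℕ} (hn : 0 < n) :
    ∑ j, P.rise n j - ∑ j, g * P.eff.σ j ≤ P.optimalPath n n := by
  rw [P.optimalPath_self hn, ← Finset.sum_sub_distrib]
  refine Finset.sum_le_sum fun j _ => ?_
  have hg := g_pos
  have hσ := P.eff.σ_pos j
  have hT := P.gapTime_pos hn j
  have h1 : P.gapTime n j ≤ P.eff.gens n j + 1 := by
    rw [gens_cast]
    unfold gapTime effTime
    linarith [P.eff.lam_mul_lt_cut n j.succ, P.eff.cut_le_lam_mul n j.castSucc]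
  have h2 : (P.eff.gens n j : ℝ) - 1 ≤ P.gapTime n j := by
    rw [gens_cast]
    unfold gapTime effTime
    linarith [P.eff.lam_mul_lt_cut n j.castSucc, P.eff.cut_le_lam_mul n j.succ]
  have h3 := mul_le_mul_of_nonneg_left h2 (show 0 ≤ g * P.eff.σ j by positivity)
  have h4 := mul_le_mul_of_nonneg_left (Real.log_le_log hT h1)
    (show 0 ≤ (1 + 2 * (P.δ j : ℝ)) * P.eff.σ j / (2 * g) by positivity)
  unfold rise
  linarith

/-! ### Chaining the effective stretches -/

/-- The variances of the generations `p, …, q - 1`. -/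
noncomputable def variances (P : Profile) (n p q : ℕ) : List ℝ≥0 :=
  (List.Ico p q).map fun k => Real.toNNReal (P.stepSize n k ^ 2)

lemma variances_append (P : Profile) (n : ℕ) {p q r : ℕ} (hpq : p ≤ q) (hqr : q ≤ r) :
    P.variances n p q ++ P.variances n q r = P.variances n p r := by
  unfold variances
  rw [← List.map_append, List.Ico.append_consecutive hpq hqr]

lemma variances_zero (P : Profile) (n : ℕ) :
    P.variances n 0 n = List.ofFn fun k : Fin n => Real.toNNReal (P.stepSize n k ^ 2) := by
  refine List.ext_getElem (by simp [variances]) fun i h1 h2 => ?_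
  simp [variances, List.Ico.zero_bot]

lemma length_variances (P : Profile) (n p q : ℕ) : (P.variances n p q).length = q - p := by
  simp [variances]

lemma sum_variances (P : Profile) (n p q : ℕ) :
    ((P.variances n p q).sum : ℝ) = ∑ k ∈ Finset.Ico p q, P.stepSize n k ^ 2 := by
  have h : (P.variances n p q).sum =
      ∑ k ∈ Finset.Ico p q, Real.toNNReal (P.stepSize n k ^ 2) := rfl
  rw [h]
  push_cast
  exact Finset.sum_congr rfl fun k _ => Real.coe_toNNReal _ (sq_nonneg _)

lemma δ_le_one (P : Profile) (j : Fin P.eff.M) : P.δ j ≤ 1 := by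
  unfold δ
  split_ifs <;> norm_num

/-- One effective stretch: an exponential bound with a rate beyond the critical one is turned into
the critical exponential, with a linear factor if the stretch is homogeneous. -/
theorem exists_stretch_le (P : Profile) (j : Fin P.eff.M) {ρ C : ℝ} (hρ : g / P.eff.σ j < ρ)
    (hC : 1 ≤ C) : ∃ C' : ℝ, 1 ≤ C' ∧ ∀ (n : ℕ) (f : ℝ → ℝ≥0∞) (β : ℝ), Measurable f →
      (∀ s, min 1 (f s) ≤ ENNReal.ofReal (C * Real.exp (ρ * (s - β)))) → ∀ s,
        min 1 ((P.variances n (P.eff.cut n j.castSucc) (P.eff.cut n j.succ)).foldr branchStep f s) ≤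
          ENNReal.ofReal (C' * (1 + max 0 (β - P.rise n j - s)) ^ P.δ j *
            Real.exp (-(g / P.eff.σ j * (β - P.rise n j - s)))) := by
  have hg := g_pos
  have hσ := P.eff.σ_pos j
  have hmin : ∀ (f : ℝ → ℝ≥0∞) s, min 1 (f s) ≤ min 1 ((fun s => min 1 (f s)) s) := fun f s => by
    simp
  by_cases hc : P.Coincide (P.eff.lam j.castSucc) (P.eff.lam j.succ)
  · have hδ : P.δ j = 1 := if_pos hc
    obtain ⟨C', hC', hmain⟩ := exists_foldr_replicate_le hσ hρ (zero_le_one.trans hC)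
    have hA : 0 < C' * (2 + 1 / P.eff.σ j) := by positivity
    refine ⟨1 + C' * (2 + 1 / P.eff.σ j), by linarith, fun n f β hf hfb s => ?_⟩
    have hlist : P.variances n (P.eff.cut n j.castSucc) (P.eff.cut n j.succ) =
        List.replicate (P.eff.gens n j) (Real.toNNReal (P.eff.σ j ^ 2)) := by
      refine List.eq_replicate_iff.2 ⟨P.length_variances _ _ _, fun v hv => ?_⟩
      obtain ⟨k, hk, rfl⟩ := List.mem_map.1 hv
      rw [P.stepSize_eq_of_coincide hc (Finset.mem_Ico.2 (List.Ico.mem.1 hk))]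
    rw [hδ, pow_one]
    set y := β - P.rise n j - s with hy
    -- At or beyond the barrier the right-hand side is at least `1`; below it the homogeneous
    -- estimate applies at distance `y / σ̄_j`.
    rcases le_or_gt y 0 with hy0 | hy0
    · refine (min_le_left _ _).trans ?_
      rw [← ENNReal.ofReal_one]
      refine ENNReal.ofReal_le_ofReal ?_
      rw [max_eq_left hy0]
      have : 0 ≤ -(g / P.eff.σ j * y) := by
        rw [neg_nonneg]
        exact mul_nonpos_of_nonneg_of_nonpos (by positivity) hy0
      have := Real.one_le_exp this
      nlinarith
    · refine (min_foldr_branchStep_mono (hmin f) _ s).trans ((min_le_right _ _).trans ?_)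
      rw [hlist]
      have h1 := hmain (P.eff.gens n j) (Real.toNNReal (P.eff.σ j ^ 2)) (fun s => min 1 (f s)) β
        (Real.coe_toNNReal _ (sq_nonneg _)) (measurable_const.min hf) hfb (y / P.eff.σ j)
        (by positivity)
      have h2 : β - (g * P.eff.σ j * P.eff.gens n j -
          3 * P.eff.σ j / (2 * g) * Real.log (P.eff.gens n j + 1)) -
            P.eff.σ j * (y / P.eff.σ j) = s := by
        rw [mul_div_cancel₀ _ hσ.ne', hy, rise, hδ]
        push_cast
        ring
      rw [h2] at h1
      refine h1.trans (ENNReal.ofReal_le_ofReal ?_)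
      rw [max_eq_right hy0.le, show g * (y / P.eff.σ j) = g / P.eff.σ j * y by ring]
      refine mul_le_mul_of_nonneg_right ?_ (Real.exp_nonneg _)
      have h3 : y / P.eff.σ j + 2 ≤ (2 + 1 / P.eff.σ j) * (1 + y) := by
        have : 0 < 1 / P.eff.σ j := by positivity
        rw [div_eq_mul_one_div]
        nlinarith
      have := mul_le_mul_of_nonneg_left h3 hC'.le
      nlinarith
  · have hδ : P.δ j = 0 := if_neg hc
    obtain ⟨κ, hκ, hκle⟩ := P.exists_stepSize_sq_ge
    obtain ⟨C', hC', hmain⟩ := exists_foldr_le_of_sum_le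
      (K := P.eff.σ j ^ 2 + P.sqBound * (P.M + 2)) hσ hρ hC hκ
    refine ⟨1 + C', by linarith, fun n f β hf hfb s => ?_⟩
    refine (min_foldr_branchStep_mono (hmin f) _ s).trans ((min_le_right _ _).trans ?_)
    have hlen := P.length_variances n (P.eff.cut n j.castSucc) (P.eff.cut n j.succ)
    have h1 := hmain (P.variances n (P.eff.cut n j.castSucc) (P.eff.cut n j.succ))
      (fun s => min 1 (f s)) β (by
        rw [sum_variances, hlen]
        exact P.eff_spec.sum_stepSize_sq_le n j) (by
        rw [sum_variances, hlen, mul_comm, ← nsmul_eq_mul, ← Nat.card_Ico]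
        exact Finset.card_nsmul_le_sum _ _ _ fun k hk => hκle n k
          (lt_of_lt_of_le (Finset.mem_Ico.1 hk).2 (P.eff.cut_le n _)))
      (measurable_const.min hf) (fun s => min_le_left _ _) hfb s
    refine h1.trans (ENNReal.ofReal_le_ofReal ?_)
    have h2 : β - (g * P.eff.σ j * (P.variances n (P.eff.cut n j.castSucc)
        (P.eff.cut n j.succ)).length - P.eff.σ j / (2 * g) * Real.log ((P.variances n
          (P.eff.cut n j.castSucc) (P.eff.cut n j.succ)).length + 1)) - s = β - P.rise n j - s := by
      rw [hlen, rise, hδ, gens]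
      push_cast
      ring
    rw [h2, hδ, pow_zero, mul_one]
    gcongr
    linarith

/-- The critical rates of the effective stretches are strictly increasing. -/
lemma exists_rate (P : Profile) (j : Fin P.eff.M) : ∃ ρ, g / P.eff.σ j < ρ ∧
    ∀ i : Fin P.eff.M, j.succ ≤ i.castSucc → ρ < g / P.eff.σ i := by
  have hmono : ∀ i : Fin P.eff.M, j.succ ≤ i.castSucc → g / P.eff.σ j < g / P.eff.σ i :=
    fun i hi => div_lt_div_of_pos_left g_pos (P.eff.σ_pos i)
      (show P.eff.σ i < P.eff.σ j from P.eff_spec.1 (Fin.succ_le_castSucc_iff.1 hi))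
  have hev : ∀ᶠ t in nhdsWithin (g / P.eff.σ j) (Ioi (g / P.eff.σ j)),
      ∀ i : Fin P.eff.M, j.succ ≤ i.castSucc → t < g / P.eff.σ i := by
    refine Filter.eventually_all.2 fun i => ?_
    by_cases hi : j.succ ≤ i.castSucc
    · filter_upwards [nhdsWithin_le_nhds (Iio_mem_nhds (hmono i hi))] with t ht _ using ht
    · exact Filter.Eventually.of_forall fun t h => absurd h hi
  obtain ⟨t, ht1, ht2⟩ := (hev.and self_mem_nhdsWithin).exists
  exact ⟨t, ht2, ht1⟩

lemma sum_filter_castSucc_le {m : ℕ} (f : Fin m → ℝ) (j : Fin m) :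
    ∑ i ∈ Finset.univ.filter (fun i : Fin m => j.castSucc ≤ i.castSucc), f i =
      f j + ∑ i ∈ Finset.univ.filter (fun i : Fin m => j.succ ≤ i.castSucc), f i := by
  have hfilter : Finset.univ.filter (fun i : Fin m => j.castSucc ≤ i.castSucc) =
      insert j (Finset.univ.filter fun i : Fin m => j.succ ≤ i.castSucc) := by
    ext i
    simp only [Finset.mem_filter, Finset.mem_univ, true_and, Finset.mem_insert,
      Fin.castSucc_le_castSucc_iff, Fin.succ_le_castSucc_iff]
    rw [le_iff_eq_or_lt, eq_comm]
  rw [hfilter, Finset.sum_insert]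
  simp only [Finset.mem_filter, Finset.mem_univ, true_and, Fin.succ_le_castSucc_iff, lt_irrefl,
    not_false_eq_true]

/-- All stretches from the `j`-th on, at any rate below all their critical rates. -/
theorem exists_stretches_le (P : Profile) (j : Fin (P.eff.M + 1)) : ∀ ρ : ℝ, 0 < ρ →
    (∀ i : Fin P.eff.M, j ≤ i.castSucc → ρ < g / P.eff.σ i) → ∃ C : ℝ, 1 ≤ C ∧
      ∀ (n : ℕ) (β s : ℝ),
        min 1 ((P.variances n (P.eff.cut n j) n).foldr branchStep ((Ici β).indicator 1) s) ≤
          ENNReal.ofReal (C * Real.exp (ρ * (s - (β -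
            ∑ i ∈ Finset.univ.filter (fun i : Fin P.eff.M => j ≤ i.castSucc), P.rise n i)))) := by
  induction j using Fin.reverseInduction with
  | last =>
    intro ρ hρ _
    refine ⟨1, le_rfl, fun n β s => ?_⟩
    have hemp : Finset.univ.filter (fun i : Fin P.eff.M => Fin.last P.eff.M ≤ i.castSucc) = ∅ :=
      Finset.filter_false_of_mem fun i _ => not_le.2 (Fin.castSucc_lt_last i)
    have hnil : P.variances n (P.eff.cut n (Fin.last P.eff.M)) n = [] := by
      rw [cut_last]
      exact List.length_eq_zero_iff.1 ((P.length_variances n n n).trans (Nat.sub_self n))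
    rw [hemp, hnil, Finset.sum_empty, sub_zero, one_mul]
    refine (min_le_right _ _).trans ?_
    by_cases hs : β ≤ s
    · rw [List.foldr_nil, indicator_of_mem (mem_Ici.2 hs), Pi.one_apply, ← ENNReal.ofReal_one]
      exact ENNReal.ofReal_le_ofReal (Real.one_le_exp (mul_nonneg hρ.le (by linarith)))
    · simp [indicator_of_notMem (show s ∉ Ici β from hs)]
  | cast j ih =>
    intro ρ hρ hlt
    have hg := g_pos
    have hσ := P.eff.σ_pos j
    have hjρ := hlt j le_rfl
    -- `ρ'` lies strictly between the critical rate of this stretch and those of all later ones, so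
    -- it is admissible both for the induction hypothesis and as input to this stretch.
    obtain ⟨ρ', hρ', hlt'⟩ := P.exists_rate j
    obtain ⟨C, hC, hnext⟩ := ih ρ' ((div_pos hg hσ).trans hρ') hlt'
    obtain ⟨C', hC', hstretch⟩ := P.exists_stretch_le j hρ' hC
    have ha : 0 < g / P.eff.σ j - ρ := sub_pos.2 hjρ
    set a := g / P.eff.σ j - ρ with hadef
    refine ⟨C' * (1 + 1 / a), ?_, fun n β s => ?_⟩
    · have : 0 < 1 / a := by positivity
      nlinarith
    rw [sum_filter_castSucc_le,
      ← P.variances_append n (P.eff.cut_mono n Fin.castSucc_lt_succ.le) (P.eff.cut_le n j.succ),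
      List.foldr_append]
    have h1 := hstretch n ((P.variances n (P.eff.cut n j.succ) n).foldr branchStep
      ((Ici β).indicator 1)) _ (measurable_foldr_branchStep (measurable_one.indicator
        measurableSet_Ici) _) (hnext n β) s
    set y := β - ∑ i ∈ Finset.univ.filter (fun i : Fin P.eff.M => j.succ ≤ i.castSucc), P.rise n i -
      P.rise n j - s with hy
    have hexp : ρ * (s - (β - (P.rise n j + ∑ i ∈ Finset.univ.filter
        (fun i : Fin P.eff.M => j.succ ≤ i.castSucc), P.rise n i))) = -(ρ * y) := by
      rw [hy]
      ring
    rw [hexp]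
    have h1a : 0 < 1 / a := by positivity
    rcases le_or_gt y 0 with hy0 | hy0
    · refine (min_le_left _ _).trans ?_
      rw [← ENNReal.ofReal_one]
      refine ENNReal.ofReal_le_ofReal (one_le_mul_of_one_le_of_one_le (by nlinarith)
        (Real.one_le_exp ?_))
      nlinarith
    · refine h1.trans (ENNReal.ofReal_le_ofReal ?_)
      rw [max_eq_right hy0.le]
      -- Giving up the part `a` of the rate pays for the linear factor, since `1 + y ≤ (1 + 1/a)
      -- exp(a y)`.
      have hpow : (1 + y) ^ P.δ j ≤ (1 + 1 / a) * Real.exp (a * y) := by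
        have hp1 : (1 + y) ^ P.δ j ≤ (1 + y) ^ 1 :=
          pow_le_pow_right₀ (by linarith) (P.δ_le_one j)
        have hp2 : a * y + 1 ≤ Real.exp (a * y) := Real.add_one_le_exp _
        have hp3 : 1 + y ≤ (1 + 1 / a) * (a * y + 1) := by
          have : (1 + 1 / a) * (a * y + 1) = 1 + y + (a * y + 1 / a) := by
            field_simp
            ring
          have : 0 < a * y := by positivity
          linarith
        rw [pow_one] at hp1
        exact hp1.trans (hp3.trans (mul_le_mul_of_nonneg_left hp2 (by positivity)))
      have hsplit : Real.exp (-(ρ * y)) =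
          Real.exp (a * y) * Real.exp (-(g / P.eff.σ j * y)) := by
        rw [← Real.exp_add, hadef]
        congr 1
        ring
      calc C' * (1 + y) ^ P.δ j * Real.exp (-(g / P.eff.σ j * y))
          ≤ C' * ((1 + 1 / a) * Real.exp (a * y)) * Real.exp (-(g / P.eff.σ j * y)) := by gcongr
        _ = _ := by rw [hsplit]; ring

/-- The walk from the root, with all effective stretches. -/
theorem exists_foldr_variances_le (P : Profile) : ∃ C : ℝ, 1 ≤ C ∧ ∀ (n : ℕ) (y : ℝ),
    min 1 ((P.variances n 0 n).foldr branchStep ((Ici (∑ j, P.rise n j + y)).indicator 1) 0) ≤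
      ENNReal.ofReal (C * (1 + max 0 y) ^ P.δ ⟨0, P.eff.M_pos⟩ *
        Real.exp (-(g / P.eff.firstσ * y))) := by
  set j : Fin P.eff.M := ⟨0, P.eff.M_pos⟩ with hj
  obtain ⟨ρ, hρ, hlt⟩ := P.exists_rate j
  obtain ⟨C, hC, hnext⟩ := P.exists_stretches_le j.succ ρ
    ((div_pos g_pos (P.eff.σ_pos j)).trans hρ) hlt
  -- For the first stretch no rate is sacrificed, so its linear factor stays and the decay is
  -- exactly at `g / σ̄_1`.
  obtain ⟨C', hC', hstretch⟩ := P.exists_stretch_le j hρ hC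
  refine ⟨C', hC', fun n y => ?_⟩
  have hj0 : j.castSucc = 0 := rfl
  have h1 := hstretch n ((P.variances n (P.eff.cut n j.succ) n).foldr branchStep
    ((Ici (∑ j, P.rise n j + y)).indicator 1)) _ (measurable_foldr_branchStep
      (measurable_one.indicator measurableSet_Ici) _) (hnext n (∑ j, P.rise n j + y)) 0
  have hsum := sum_filter_castSucc_le (P.rise n) j
  rw [Finset.filter_true_of_mem fun i _ => by rw [hj0]; exact Fin.zero_le _] at hsum
  have hy : ∑ j, P.rise n j + y - ∑ i ∈ Finset.univ.filter
      (fun i : Fin P.eff.M => j.succ ≤ i.castSucc), P.rise n i - P.rise n j - 0 = y := by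
    rw [hsum]
    ring
  rw [hy, ← List.foldr_append, P.variances_append n (P.eff.cut_mono n Fin.castSucc_lt_succ.le)
    (P.eff.cut_le n j.succ), hj0, cut_zero] at h1
  exact h1

end Profile

end BRW

/-! ### The tail of the maximum -/

theorem lemma5 (P : BRW.Profile) (hP : P.Restricted) :
    ∃ C : ℝ, 0 < C ∧ ∃ N : ℕ, ∀ n : ℕ, N ≤ n → ∀ x : ℝ, 0 < x →
      ∀ (Ω : Type*) [MeasurableSpace Ω] (μ : Measure Ω) [IsProbabilityMeasure μ]
        (Z : BRW.Vertex n → Ω → ℝ),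
        (∀ w, HasLaw (Z w) (gaussianReal 0 1) μ) → iIndepFun Z μ →
        μ.real {ω | P.optimalPath n n + x ≤ BRW.maxWalk P Z ω} ≤
          C * (1 + x) ^ (2 * ∑ j, P.δ j) * Real.exp (-x * (BRW.g / P.eff.firstσ)) := by
  obtain ⟨C, hC, hmain⟩ := P.exists_foldr_variances_le
  set K := ∑ j, BRW.g * P.eff.σ j with hK
  have hK0 : 0 ≤ K := Finset.sum_nonneg fun j _ => (mul_pos BRW.g_pos (P.eff.σ_pos j)).le
  set θ := BRW.g / P.eff.firstσ with hθ
  -- `K` bounds the rounding error in the centring; replacing `x` by `x - K` costs the factor `exp(θ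
  -- K)`. Positivity of the effective gaps needs only `n ≥ 1`.
  refine ⟨C * Real.exp (θ * K), by positivity, 1, fun n hn x hx Ω _ μ _ Z hlaw hind => ?_⟩
  refine ENNReal.toReal_le_of_le_ofReal (by positivity) ?_
  have hsub : {ω | P.optimalPath n n + x ≤ BRW.maxWalk P Z ω} ⊆
      {ω | ∃ v : BRW.Particle n, 0 + BRW.endpoint (fun k : Fin n => P.stepSize n k)
        (fun w => Z w ω) v ∈ Ici (∑ j, P.rise n j + (x - K))} := by
    intro ω hω
    obtain ⟨v, -, hv⟩ := (Finset.le_sup'_iff _).1 (show P.optimalPath n n + x ≤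
      Finset.univ.sup' Finset.univ_nonempty fun v : BRW.Particle n => BRW.walk P Z v n ω from hω)
    refine ⟨v, ?_⟩
    rw [zero_add, mem_Ici, ← P.walk_eq_endpoint]
    have := P.sum_rise_le_optimalPath (show 0 < n from hn)
    linarith
  have h1 := BRW.measure_exists_endpoint_le (A := Ici (∑ j, P.rise n j + (x - K)))
    measurableSet_Ici μ n (fun k : Fin n => P.stepSize n k) Z hlaw hind 0
  rw [← P.variances_zero] at h1
  refine (measure_mono hsub).trans ((le_min prob_le_one h1).trans ((hmain n (x - K)).trans
    (ENNReal.ofReal_le_ofReal ?_)))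
  -- The argument gives the exponent `δ_1` alone, and `1 + x ≥ 1` allows raising it to the stated
  -- one.
  have hδ : P.δ ⟨0, P.eff.M_pos⟩ ≤ 2 * ∑ j, P.δ j := by
    have := Finset.single_le_sum (f := P.δ) (fun _ _ => Nat.zero_le _)
      (Finset.mem_univ ⟨0, P.eff.M_pos⟩)
    omega
  have hpow : (1 + max 0 (x - K)) ^ P.δ ⟨0, P.eff.M_pos⟩ ≤ (1 + x) ^ (2 * ∑ j, P.δ j) :=
    (pow_le_pow_left₀ (by positivity) (by
      have := max_le hx.le (show x - K ≤ x by linarith)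
      linarith) _).trans (pow_le_pow_right₀ (by linarith) hδ)
  have hexp : Real.exp (-(θ * (x - K))) = Real.exp (θ * K) * Real.exp (-x * θ) := by
    rw [← Real.exp_add]
    congr 1
    ring
  calc C * (1 + max 0 (x - K)) ^ P.δ ⟨0, P.eff.M_pos⟩ * Real.exp (-(θ * (x - K)))
      ≤ C * (1 + x) ^ (2 * ∑ j, P.δ j) * Real.exp (-(θ * (x - K))) := by gcongr
    _ = _ := by rw [hexp]; ring
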